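/- **Setting.** Let $T=[0,1)\times[0,1)$ be the torus with coordinates $(q,p)$, and let $\mathcal U$ be the triadic baker map, $\mathcal U(q,p)=(3q-j,\frac{p+j}{3})$ for $\frac j3\le q<\frac{j+1}3$, $j\in\{0,1,2\}$. It is opened at the hole $O=[\frac13,\frac23)\times[0,1)$, with trapped sets $K_-=T\setminus\bigcup_{m\ge0}\mathcal U^{-m}(O)$, $K_+=T\setminus\bigcup_{m\ge1}\mathcal U^{m}(O)$ and repeller $K_0=K_+\cap K_-$. A measure $\rho$ on $T$ is an eigenmeasure of the open map with eigenvalue $\Lambda$ if $\rho(\mathcal U^{-1}(A)\setminus O)=\Lambda\rho(A)$ for every Borel set $A$. For $\epsilon=\epsilon_1\cdots\epsilon_b\in\{0,1,2\}^b$ let $[\epsilon]=[a,a+3^{-b})$ with $a=\sum_{i}\epsilon_i3^{-i}$, and let $[\epsilon'\cdot\epsilon]$ be the rectangle $\{q\in[\epsilon],\ p\in[\epsilon']\}$, called a $v$-square if $\epsilon,\epsilon'$ both have length $v$. For $N=3^k$, $k\ge1$, identify $\mathbb C^N=(\mathbb C^3)^{\otimes k}$ through $|j\rangle=|\epsilon_1\rangle\otimes\cdots\otimes|\epsilon_k\rangle$,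 $j=\sum_\ell\epsilon_\ell3^{k-\ell}$. Let $(F_3)_{nm}=\frac1{\sqrt3}e^{-\frac{2\pi i}3(n+\frac12)(m+\frac12)}$ for $n,m\in\{0,1,2\}$, let $W_{N}(v_1\otimes\cdots\otimes v_k)=F_3v_k\otimes\cdots\otimes F_3v_1$ be the Walsh-Fourier transform, and let $B=W_N^\dagger\,\mathrm{diag}(W_{N/3},0,W_{N/3})$ be the open Walsh-baker map. For $0\le b\le k$, $\epsilon\in\{0,1,2\}^b$ and $\epsilon'\in\{0,1,2\}^{k-b}$ put $|\epsilon'\cdot\epsilon\rangle_b=|\epsilon_1\rangle\otimes\cdots\otimes|\epsilon_b\rangle\otimes F_3^\dagger|\epsilon'_{k-b}\rangle\otimes\cdots\otimes F_3^\dagger|\epsilon'_1\rangle$. The Walsh-Husimi measure $H^b_\psi$ of a unit vector $\psi\in\mathbb C^N$ is the probability measure on $T$ that gives each rectangle $[\epsilon'\cdot\epsilon]$ of this size the mass $|\langle\psi|\epsilon'\cdot\epsilon\rangle_b|^2$, spread uniformly over the rectangle. Let $\nu_{\rm Can}$ and $\nu_{\min}$ be the probability measures on $[0,1)$ determined, for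 all $n$ and $\epsilon\in\{0,1,2\}^n$, by $\nu_{\rm Can}([\epsilon])=2^{-n}$ if all $\epsilon_i\in\{0,2\}$ and $0$ otherwise, and by $\nu_{\min}([\epsilon])=\prod_{i=1}^n w_{\epsilon_i}$ with $(w_0,w_1,w_2)=(\frac16,\frac23,\frac16)$. Put $\rho_{\max}=\nu_{\rm Can}(dp)\times\nu_{\rm Can}(dq)$ and $\rho_{\min}=\nu_{\rm Can}(dp)\times\nu_{\min}(dq)$. **Theorem.** Let $(\Psi_n)$ be a sequence of normalized right eigenstates of the open Walsh-baker maps $B$ of sizes $3^{k_n}$, with $k_n\to\infty$ and eigenvalues $z_n$. 1. (Outer edge.) If $|z_n|\to1$, then the measures $H^{[k_n/2]}_{\Psi_n}$ converge weak-$*$ to $\rho_{\max}$, and their masses of every fixed $v$-square converge to that of $\rho_{\max}$. Moreover $\rho_{\max}$ is the only measure on $T$ that is the limit of all such sequences, it is invariant under $\mathcal U$, and it is supported on the repeller: $\rho_{\max}(T\setminus K_0)=0$. 2. (Inner edge.) If $|z_n|\to1/\sqrt3$, then the measures $H^{[k_n/2]}_{\Psi_n}$ converge in the same sense to $\rho_{\min}$.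 Moreover $\rho_{\min}$ is the only measure on $T$ that is the limit of all such sequences, it is an eigenmeasure of the open map with eigenvalue $\frac13$, and it is supported on $K_+$: $\rho_{\min}(T\setminus K_+)=0$. The measures $\nu_{\min}$ and $\rho_{\min}$ are self-similar: with $S_j(x)=\frac{x+j}3$ and $(u_0,u_1,u_2)=(\frac12,0,\frac12)$, $$\nu_{\min}=\sum_{i=0}^2w_i\,(S_i)_*\nu_{\min},\qquad \rho_{\min}=\sum_{i,j=0}^2w_iu_j\,(S_i\times S_j)_*\rho_{\min},$$ where $S_i\times S_j$ acts on $(q,p)$ as $(S_iq,S_jp)$. -/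

import Mathlib

open MeasureTheory Filter Topology
open scoped ENNReal Matrix

namespace WalshBaker

noncomputable section

/-! ### Classical side: triadic rectangles, baker map, trapped sets.
Phase space is the torus `T = [0,1) × [0,1)` with coordinates `(q, p)`,
viewed as a subset of `ℝ × ℝ`. -/

/-- The fundamental domain `[0,1) × [0,1)` of the torus. -/
def torus : Set (ℝ × ℝ) := Set.Ico 0 1 ×ˢ Set.Ico 0 1

/-- The triadic interval `[ε₁⋯ε_b]`: all `x` in `[0,1)` whose ternary expansion starts with
`ε₁, …, ε_b` (where `ε₁` is `ε 0`). -/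
def triadicInterval {b : ℕ} (ε : Fin b → Fin 3) : Set ℝ :=
  Set.Ico (∑ i, ((ε i : ℕ) : ℝ) / 3 ^ ((i : ℕ) + 1))
    (∑ i, ((ε i : ℕ) : ℝ) / 3 ^ ((i : ℕ) + 1) + 1 / 3 ^ b)

/-- The rectangle `[ε'·ε]`: position `q` in `[ε]`, momentum `p` in `[ε']`. -/
def rectangle {b' b : ℕ} (ε' : Fin b' → Fin 3) (ε : Fin b → Fin 3) : Set (ℝ × ℝ) :=
  triadicInterval ε ×ˢ triadicInterval ε'

/-- The closed triadic baker map (only its values on `torus` matter). -/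
def baker (x : ℝ × ℝ) : ℝ × ℝ :=
  if x.1 < 1 / 3 then (3 * x.1, x.2 / 3)
  else if x.1 < 2 / 3 then (3 * x.1 - 1, (x.2 + 1) / 3)
  else (3 * x.1 - 2, (x.2 + 2) / 3)

/-- The opening: the middle vertical strip. -/
def hole : Set (ℝ × ℝ) := Set.Ico (1 / 3) (2 / 3) ×ˢ Set.Ico 0 1

/-- The forward-trapped set `K₋`. -/
def forwardTrapped : Set (ℝ × ℝ) := torus \ ⋃ m : ℕ, baker^[m] ⁻¹' hole

/-- The backward-trapped set `K₊`. -/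
def backwardTrapped : Set (ℝ × ℝ) := torus \ ⋃ m : ℕ, baker^[m + 1] '' hole

/-- The repeller `K₀ = K₊ ∩ K₋`. -/
def repeller : Set (ℝ × ℝ) := backwardTrapped ∩ forwardTrapped

/-- `ρ` is an eigenmeasure (conditionally invariant measure) of the open baker map with
eigenvalue `Λ`: the preimage of `A` under the open map is `baker ⁻¹' A \ hole`. -/
def IsEigenmeasure (Λ : ℝ≥0∞) (ρ : Measure (ℝ × ℝ)) : Prop :=
  ∀ A : Set (ℝ × ℝ), MeasurableSet A → ρ (baker ⁻¹' A \ hole) = Λ * ρ A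

/-- Law on `[0,1]` of `∑ εᵢ 3⁻ⁱ` with independent digits `εᵢ` of law `w`. -/
def bernoulliMeasure (w : PMF (Fin 3)) : Measure ℝ :=
  (Measure.infinitePi fun _ : ℕ => w.toMeasure).map (fun ε => Real.ofDigits ε)

/-- Digit weights `(1/2, 0, 1/2)`. -/
def canDigits : PMF (Fin 3) := PMF.ofFintype ![2⁻¹, 0, 2⁻¹] (by
  simp [Fin.sum_univ_three, ENNReal.inv_two_add_inv_two])

/-- Digit weights `(1/6, 2/3, 1/6)`, the squared moduli of the entries of
`f₊ = (1, 2, 1) / √6`. -/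
def minDigits : PMF (Fin 3) := PMF.ofFintype
  (fun i => ENNReal.ofReal (![1 / 6, 2 / 3, 1 / 6] i)) (by
  simp only [Fin.sum_univ_three, Matrix.cons_val_zero, Matrix.cons_val_one, Matrix.cons_val]
  rw [← ENNReal.ofReal_add (by norm_num) (by norm_num),
    ← ENNReal.ofReal_add (by norm_num) (by norm_num)]
  norm_num)

/-- The uniform measure on the middle-third Cantor set. -/
def nuCan : Measure ℝ := bernoulliMeasure canDigits

/-- The self-similar measure `ν_min`. -/
def nuMin : Measure ℝ := bernoulliMeasure minDigits

/-- `ρ_max = ν_Can(dp) × ν_Can(dq)`. -/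
def rhoMax : Measure (ℝ × ℝ) := nuCan.prod nuCan

/-- `ρ_min = ν_Can(dp) × ν_min(dq)`; the first coordinate is `q`. -/
def rhoMin : Measure (ℝ × ℝ) := nuMin.prod nuCan

/-! ### Quantum side. The position basis of the `3^k`-dimensional space is labelled by the
`k` ternary digits `ε₁, …, ε_k` of `j = ∑ ε_ℓ 3^(k-ℓ)`. -/

/-- The Hilbert space of dimension `N = 3^k`. -/
abbrev QState (k : ℕ) : Type := EuclideanSpace ℂ (Fin k → Fin 3)

/-- The antiperiodic Fourier matrix `F₃`. -/
def F3 : Matrix (Fin 3) (Fin 3) ℂ := Matrix.of fun n m =>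
  ((Real.sqrt 3 : ℝ) : ℂ)⁻¹ *
    Complex.exp (-(2 * Real.pi * Complex.I / 3) * ((n : ℕ) + 1 / 2) * ((m : ℕ) + 1 / 2))

/-- The Walsh-Fourier transform `W_N`, `N = 3^k`; the digits of the column index are reversed. -/
def walsh (k : ℕ) : Matrix (Fin k → Fin 3) (Fin k → Fin 3) ℂ := Matrix.of fun j j' =>
  ∏ l : Fin k, F3 (j l) (j' l.rev)

/-- The block matrix `diag(W_{N/3}, 0, W_{N/3})`, `N = 3^(k+1)`; the block is selected by the
first digit. -/
def openBlocks (k : ℕ) : Matrix (Fin (k + 1) → Fin 3) (Fin (k + 1) → Fin 3) ℂ :=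
  Matrix.of fun j j' =>
    if j 0 = j' 0 ∧ j 0 ≠ 1 then walsh k (Fin.tail j) (Fin.tail j') else 0

/-- The open Walsh-baker matrix `B = W_N^† diag(W_{N/3}, 0, W_{N/3})`, `N = 3^k`.
It is meaningful for `k ≥ 1`; the value at `k = 0` is a placeholder. -/
def openWalshBaker : (k : ℕ) → Matrix (Fin k → Fin 3) (Fin k → Fin 3) ℂ
  | 0 => 0
  | k + 1 => (walsh (k + 1))ᴴ * openBlocks k

/-- The Walsh coherent state
`|ε'·ε⟩_b = |ε₁⟩ ⊗ ⋯ ⊗ |ε_b⟩ ⊗ F₃^†|ε'_{k-b}⟩ ⊗ ⋯ ⊗ F₃^†|ε'_1⟩` (for `b ≤ k`). -/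
def coherentState (k b : ℕ) (ε' : Fin (k - b) → Fin 3) (ε : Fin b → Fin 3) : QState k :=
  WithLp.toLp 2 fun x => ∏ i : Fin k,
    if h : (i : ℕ) < b then (if x i = ε ⟨i, h⟩ then 1 else 0)
    else F3ᴴ (x i) (ε' ⟨k - 1 - i, by omega⟩)

/-- The weight `|⟨ψ|ε'·ε⟩_b|²` of a quantum rectangle. -/
def husimiWeight (k b : ℕ) (ψ : QState k) (ε' : Fin (k - b) → Fin 3) (ε : Fin b → Fin 3) : ℝ :=
  ‖inner ℂ ψ (coherentState k b ε' ε)‖ ^ 2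

/-- The Walsh-Husimi measure `H^b_ψ`: each quantum rectangle of size `b × (k-b)` carries its
weight, spread uniformly (`cond volume R` is the normalized Lebesgue measure on `R`).
Its value on a union of quantum rectangles is the sum of their weights. -/
def husimi (k b : ℕ) (ψ : QState k) : Measure (ℝ × ℝ) :=
  ∑ ε' : Fin (k - b) → Fin 3, ∑ ε : Fin b → Fin 3,
    ENNReal.ofReal (husimiWeight k b ψ ε' ε) • ProbabilityTheory.cond volume (rectangle ε' ε)

/-- `(Ψ_n)` is a semiclassical sequence of normalized right eigenstates of the open Walsh-baker
matrices of size `3^(k_n)`, `k_n → ∞`, with eigenvalues `z_n`. -/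
structure IsEigenstateSequence (k : ℕ → ℕ) (Ψ : (n : ℕ) → QState (k n)) (z : ℕ → ℂ) : Prop where
  tendsto_k : Tendsto k atTop atTop
  norm_eq_one : ∀ n, ‖Ψ n‖ = 1
  eigen : ∀ n, Matrix.toEuclideanLin (openWalshBaker (k n)) (Ψ n) = z n • Ψ n

/-- Convergence of the weights of all `v`-squares. -/
def ConvergesOnSquares (μ : ℕ → Measure (ℝ × ℝ)) (ρ : Measure (ℝ × ℝ)) : Prop :=
  ∀ (v : ℕ) (ε' ε : Fin v → Fin 3),
    Tendsto (fun n => μ n (rectangle ε' ε)) atTop (𝓝 (ρ (rectangle ε' ε)))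

/-- Convergence against continuous test functions (in particular against the continuous
functions on the torus, which are the `ℤ²`-periodic ones). -/
def ConvergesWeakStar (μ : ℕ → Measure (ℝ × ℝ)) (ρ : Measure (ℝ × ℝ)) : Prop :=
  ∀ f : ℝ × ℝ → ℝ, Continuous f →
    Tendsto (fun n => ∫ x, f x ∂(μ n)) atTop (𝓝 (∫ x, f x ∂ρ))

/-- For every sequence of right eigenstates whose eigenvalue moduli tend to `r`, the isotropic
Walsh-Husimi measures converge to `ρ`. -/
def IsEdgeLimit (r : ℝ) (ρ : Measure (ℝ × ℝ)) : Prop :=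
  ∀ (k : ℕ → ℕ) (Ψ : (n : ℕ) → QState (k n)) (z : ℕ → ℂ),
    IsEigenstateSequence k Ψ z → Tendsto (fun n => ‖z n‖) atTop (𝓝 r) →
      ConvergesOnSquares (fun n => husimi (k n) (k n / 2) (Ψ n)) ρ ∧
      ConvergesWeakStar (fun n => husimi (k n) (k n / 2) (Ψ n)) ρ

end

end WalshBaker

/-! The open Walsh-baker matrix shifts the tensor factors cyclically and applies the one-site matrix
`F₃^† π`, `π = diag(1, 0, 1)`, to the last one (`openWalshBaker_mulVec`). On its two-dimensional
range this one-site matrix is diagonal in an orthonormal basis: `f₋ = (1, 0, -1)/√2` has eigenvalue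
`1` and `f₊ = (1, 2, 1)/√6` has eigenvalue `i/√3`. The third basis vector is normal to the range.
Every site eventually passes through the last place, so an eigenstate with `z ≠ 0` has no component
along the normal at any site (`eigenCoord_eq_zero`). On the remaining strings of `f₋` and `f₊` the
map is a weighted cyclic shift (`mul_eigenCoord`).

Let `m` be the mass of the strings with `f₊` at the first site. Taking norms gives `|z|² = 1 - (2/3)
m`. Hence `|z| → 1` forces the first site into `f₋`, and `|z|² → 1/3` forces it into `f₊`. The
weights of the shift change the mass of the wrong digit by a factor of at most `3` per step, so
every site at bounded cyclic distance from the first one is forced too (`defectMass_le_pow_left`,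
`defectMass_le_pow_right`).

The Husimi mass of a `v`-square tests only the first `v` sites, in position, and the last `v` sites,
in momentum (`husimi_rectangle_eq_cylinderMass`). There the state is close to a product of copies of
one vector `f`, so the mass tends to a product of the weights `|f|²` and `|F₃ f|²`. The former give
`ν_Can` or `ν_min`. The latter give `ν_Can` at both edges, because the eigenvector equation makes
`F₃ f` a multiple of `π f`. Convergence on squares implies weak convergence by uniform approximation
with step functions. Uniqueness holds because the pure product states are exact eigenstates at each
edge.

On the classical side the limits have independent digits, and the baker map moves the leading digit
of `q` to the front of `p`. The invariance, eigenmeasure and support statements then reduce to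
comparing digit weights (`prod_baker_preimage_eq`). -/

namespace WalshBaker

noncomputable section

/-! ### Bernoulli measures -/

/-- Prepend a digit to a sequence of digits. -/
def consDigit (i : Fin 3) (ε : ℕ → Fin 3) : ℕ → Fin 3
  | 0 => i
  | n + 1 => ε n

lemma measurable_consDigit (i : Fin 3) : Measurable (consDigit i) := by
  refine measurable_pi_lambda _ fun n => ?_
  cases n with
  | zero => exact measurable_const
  | succ n => exact measurable_pi_apply n

lemma ofDigits_consDigit (i : Fin 3) (ε : ℕ → Fin 3) :
    Real.ofDigits (consDigit i ε) = (Real.ofDigits ε + ((i : ℕ) : ℝ)) / 3 := by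
  rw [Real.ofDigits_eq_sum_add_ofDigits _ 1]
  simp only [Finset.sum_range_one, Real.ofDigitsTerm, consDigit]
  push_cast
  ring

lemma infinitePi_eq_sum_map_consDigit (w : PMF (Fin 3)) :
    Measure.infinitePi (fun _ : ℕ => w.toMeasure) =
      ∑ i : Fin 3, w i • (Measure.infinitePi fun _ : ℕ => w.toMeasure).map (consDigit i) := by
  classical
  refine (Measure.eq_infinitePi _ fun s t ht => ?_).symm
  -- Cylinders over an initial segment contain the place `0`, so prepending a digit splits them into
  -- a condition on that digit and a shorter cylinder.
  obtain ⟨N, hN⟩ : ∃ N, s ⊆ Finset.range (N + 1) :=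
    ⟨s.sup id, fun x hx => Finset.mem_range.2 (Nat.lt_succ_of_le (Finset.le_sup (f := id) hx))⟩
  let t' : ℕ → Set (Fin 3) := fun n => if n ∈ s then t n else Set.univ
  have ht' : ∀ n, MeasurableSet (t' n) := fun n => by
    by_cases h : n ∈ s <;> simp [t', h]
  have hset : Set.pi (s : Set ℕ) t = Set.pi (Finset.range (N + 1) : Set ℕ) t' := by
    ext x
    simp only [Set.mem_pi, Finset.mem_coe]
    constructor
    · intro h n _
      by_cases hn : n ∈ s
      · simpa [t', hn] using h n hn
      · simp [t', hn]
    · intro h n hn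
      simpa [t', hn] using h n (hN hn)
  have hprod : ∏ i ∈ s, w.toMeasure (t i) = ∏ i ∈ Finset.range (N + 1), w.toMeasure (t' i) := by
    rw [← Finset.prod_subset hN]
    · exact Finset.prod_congr rfl fun i hi => by simp [t', hi]
    · intro i _ hi
      simp [t', hi]
  have hpre : ∀ i, consDigit i ⁻¹' (Set.pi (Finset.range (N + 1) : Set ℕ) t') =
      if i ∈ t' 0 then Set.pi (Finset.range N : Set ℕ) (fun n => t' (n + 1)) else ∅ := by
    intro i
    ext x
    by_cases hi : i ∈ t' 0
    · simp only [hi, if_true, Set.mem_preimage, Set.mem_pi, Finset.mem_coe, Finset.mem_range]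
      constructor
      · intro h n hn
        exact h (n + 1) (by omega)
      · intro h n hn
        cases n with
        | zero => exact hi
        | succ n => exact h n (by omega)
    · simp only [hi, if_false, Set.mem_preimage, Set.mem_pi, Finset.mem_coe, Finset.mem_range,
        Set.mem_empty_iff_false, iff_false]
      exact fun h => hi (h 0 (by omega))
  rw [hset, hprod, Measure.finsetSum_apply, Finset.prod_range_succ',
    PMF.toMeasure_apply_fintype, Finset.mul_sum]
  refine Finset.sum_congr rfl fun i _ => ?_
  rw [Measure.smul_apply, Measure.map_apply (measurable_consDigit i)
    (MeasurableSet.pi (Finset.countable_toSet _) fun n _ => ht' n), hpre i]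
  by_cases hi : i ∈ t' 0
  · rw [if_pos hi, Measure.infinitePi_pi _ fun n _ => ht' _, Set.indicator_of_mem hi,
      smul_eq_mul, mul_comm]
  · rw [if_neg hi, Set.indicator_of_notMem hi]
    simp

/-- The contraction `S_i x = (x + i) / 3`. -/
def contract (i : Fin 3) (x : ℝ) : ℝ := (x + ((i : ℕ) : ℝ)) / 3

lemma measurableEmbedding_contract (i : Fin 3) : MeasurableEmbedding (contract i) := by
  have : contract i =
      (Homeomorph.mulRight₀ (3 : ℝ)⁻¹ (by norm_num)) ∘ (Homeomorph.addRight ((i : ℕ) : ℝ)) := by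
    ext x
    simp [contract, div_eq_mul_inv]
  rw [this]
  exact (Homeomorph.measurableEmbedding _).comp (Homeomorph.measurableEmbedding _)

lemma measurable_contract (i : Fin 3) : Measurable (contract i) :=
  (measurableEmbedding_contract i).measurable

lemma measurable_ofDigits : Measurable (fun ε : ℕ → Fin 3 => Real.ofDigits ε) :=
  Real.continuous_ofDigits.measurable

instance isProbabilityMeasure_bernoulliMeasure (w : PMF (Fin 3)) :
    IsProbabilityMeasure (bernoulliMeasure w) :=
  Measure.isProbabilityMeasure_map measurable_ofDigits.aemeasurable

instance : IsProbabilityMeasure nuCan := isProbabilityMeasure_bernoulliMeasure _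
instance : IsProbabilityMeasure nuMin := isProbabilityMeasure_bernoulliMeasure _

theorem bernoulliMeasure_selfSimilar (w : PMF (Fin 3)) :
    bernoulliMeasure w = ∑ i : Fin 3, w i • (bernoulliMeasure w).map (contract i) := by
  conv_lhs => rw [bernoulliMeasure, infinitePi_eq_sum_map_consDigit]
  ext s hs
  rw [Measure.map_apply measurable_ofDigits hs, Measure.finsetSum_apply, Measure.finsetSum_apply]
  refine Finset.sum_congr rfl fun i _ => ?_
  rw [Measure.smul_apply, Measure.smul_apply, Measure.map_apply (measurable_consDigit i)
    (measurable_ofDigits hs), Measure.map_apply (measurable_contract i) hs, bernoulliMeasure,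
    Measure.map_apply measurable_ofDigits (measurable_contract i hs)]
  congr 2
  ext ε
  simp [ofDigits_consDigit, contract]

/-- Self-similarity evaluated on an arbitrary set. -/
lemma bernoulliMeasure_apply (w : PMF (Fin 3)) (s : Set ℝ) :
    bernoulliMeasure w s = ∑ i : Fin 3, w i * bernoulliMeasure w (contract i ⁻¹' s) := by
  conv_lhs => rw [bernoulliMeasure_selfSimilar, Measure.finsetSum_apply]
  exact Finset.sum_congr rfl fun i _ => by
    rw [Measure.smul_apply, (measurableEmbedding_contract i).map_apply, smul_eq_mul]

lemma bernoulliMeasure_compl_Icc (w : PMF (Fin 3)) : bernoulliMeasure w (Set.Icc 0 1)ᶜ = 0 := by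
  rw [bernoulliMeasure, Measure.map_apply measurable_ofDigits measurableSet_Icc.compl]
  have : (fun ε : ℕ → Fin 3 => Real.ofDigits ε) ⁻¹' (Set.Icc 0 1)ᶜ = ∅ := by
    ext ε
    simp [Real.ofDigits_nonneg, Real.ofDigits_le_one]
  rw [this, measure_empty]

/-- Only the string `222…` sums to `1`. In the self-similarity equation the branches `0` and `1`
pull `1` back to points outside `[0,1]`, so the atom `m` satisfies `m = w₂ m`. This is what permits
half-open intervals. -/
lemma bernoulliMeasure_singleton_one (w : PMF (Fin 3)) (hw : w 2 < 1) :
    bernoulliMeasure w {1} = 0 := by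
  have hout : ∀ x : ℝ, 1 < x → bernoulliMeasure w {x} = 0 := fun x hx =>
    measure_mono_null (by intro y hy; simp_all) (bernoulliMeasure_compl_Icc w)
  have h := bernoulliMeasure_apply w {1}
  have hpre : ∀ i : Fin 3, contract i ⁻¹' {1} = {3 - ((i : ℕ) : ℝ)} := by
    intro i
    ext x
    simp only [contract, Set.mem_preimage, Set.mem_singleton_iff]
    constructor <;> intro h <;> linarith
  simp only [hpre, Fin.sum_univ_three] at h
  norm_num [hout] at h
  by_contra h0
  have hlt : w 2 * bernoulliMeasure w {1} < 1 * bernoulliMeasure w {1} := by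
    gcongr
    exact measure_ne_top _ _
  rw [one_mul, ← h] at hlt
  exact lt_irrefl _ hlt

lemma bernoulliMeasure_compl_Ico (w : PMF (Fin 3)) (hw : w 2 < 1) :
    bernoulliMeasure w (Set.Ico 0 1)ᶜ = 0 := by
  refine measure_mono_null (t := (Set.Icc 0 1)ᶜ ∪ {1}) ?_
    (measure_union_null (bernoulliMeasure_compl_Icc w) (bernoulliMeasure_singleton_one w hw))
  intro x hx
  by_cases h : x = 1
  · exact Or.inr h
  · refine Or.inl fun hy => hx ⟨hy.1, lt_of_le_of_ne hy.2 h⟩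

/-! ### Triadic intervals -/

lemma triadicInterval_zero (ε : Fin 0 → Fin 3) : triadicInterval ε = Set.Ico 0 1 := by
  simp [triadicInterval]

/-- Removing the leading digit inverts the contraction `S_{ε₁}`; inductions on the length of digit
strings rest on this. -/
lemma mem_triadicInterval_succ {n : ℕ} (ε : Fin (n + 1) → Fin 3) (x : ℝ) :
    x ∈ triadicInterval ε ↔ 3 * x - ((ε 0 : ℕ) : ℝ) ∈ triadicInterval (Fin.tail ε) := by
  have h : ∑ i, ((ε i : ℕ) : ℝ) / 3 ^ ((i : ℕ) + 1) =
      (((ε 0 : ℕ) : ℝ) + ∑ i, ((Fin.tail ε i : ℕ) : ℝ) / 3 ^ ((i : ℕ) + 1)) / 3 := by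
    rw [Fin.sum_univ_succ, add_div, Finset.sum_div]
    simp only [Fin.val_zero, Fin.val_succ, zero_add, pow_one, Fin.tail]
    congr 1
    refine Finset.sum_congr rfl fun i _ => ?_
    rw [pow_succ _ (_ + 1), div_div]
  have h3 : (1 : ℝ) / 3 ^ (n + 1) = (1 / 3 ^ n) / 3 := by rw [pow_succ, div_div]
  simp only [triadicInterval, Set.mem_Ico, h, h3]
  constructor <;> rintro ⟨h1, h2⟩ <;> constructor <;> linarith

lemma triadicInterval_subset_Ico {n : ℕ} (ε : Fin n → Fin 3) :
    triadicInterval ε ⊆ Set.Ico 0 1 := by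
  induction n with
  | zero => rw [triadicInterval_zero]
  | succ n ih =>
    intro x hx
    have := ih _ ((mem_triadicInterval_succ ε x).1 hx)
    have h0 : ((ε 0 : ℕ) : ℝ) ≤ 2 := by
      have := (ε 0).isLt
      exact_mod_cast (by omega : (ε 0 : ℕ) ≤ 2)
    have h1 : (0 : ℝ) ≤ ((ε 0 : ℕ) : ℝ) := by positivity
    constructor <;> linarith [this.1, this.2]

lemma contract_preimage_triadicInterval_inter {n : ℕ} (ε : Fin (n + 1) → Fin 3) (i : Fin 3) :
    contract i ⁻¹' triadicInterval ε ∩ Set.Ico 0 1 =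
      if i = ε 0 then triadicInterval (Fin.tail ε) else ∅ := by
  ext x
  rw [Set.mem_inter_iff, Set.mem_preimage, mem_triadicInterval_succ]
  have hc : 3 * contract i x - ((ε 0 : ℕ) : ℝ) = x + ((i : ℕ) : ℝ) - ((ε 0 : ℕ) : ℝ) := by
    simp only [contract]; ring
  rw [hc]
  split_ifs with h
  · subst h
    rw [add_sub_cancel_right]
    exact ⟨fun h => h.1, fun h => ⟨h, triadicInterval_subset_Ico _ h⟩⟩
  · simp only [Set.mem_empty_iff_false, iff_false]
    rintro ⟨h1, h2⟩
    have h1' := triadicInterval_subset_Ico _ h1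
    apply h
    have a1 : ((i : ℕ) : ℝ) < ((ε 0 : ℕ) : ℝ) + 1 := by linarith [h1'.1, h1'.2, h2.1, h2.2]
    have a2 : ((ε 0 : ℕ) : ℝ) < ((i : ℕ) : ℝ) + 1 := by linarith [h1'.1, h1'.2, h2.1, h2.2]
    norm_cast at a1 a2
    ext
    omega

theorem bernoulliMeasure_triadicInterval (w : PMF (Fin 3)) (hw : w 2 < 1) {n : ℕ}
    (ε : Fin n → Fin 3) : bernoulliMeasure w (triadicInterval ε) = ∏ i, w (ε i) := by
  have hI := bernoulliMeasure_compl_Ico w hw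
  induction n with
  | zero =>
    rw [triadicInterval_zero, Fintype.prod_empty]
    exact (prob_compl_eq_zero_iff measurableSet_Ico).1 hI
  | succ n ih =>
    rw [bernoulliMeasure_apply, Fin.prod_univ_succ]
    have : ∀ i, bernoulliMeasure w (contract i ⁻¹' triadicInterval ε) =
        if i = ε 0 then bernoulliMeasure w (triadicInterval (Fin.tail ε)) else 0 := by
      intro i
      rw [← measure_inter_conull hI, contract_preimage_triadicInterval_inter]
      split_ifs <;> simp
    simp only [this, ih, mul_ite, mul_zero, Finset.sum_ite_eq', Finset.mem_univ, if_true]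
    rfl

lemma canDigits_zero : canDigits 0 = 2⁻¹ := by simp [canDigits, PMF.ofFintype_apply]
lemma canDigits_one : canDigits 1 = 0 := by simp [canDigits, PMF.ofFintype_apply]
lemma canDigits_two : canDigits 2 = 2⁻¹ := by simp [canDigits, PMF.ofFintype_apply]

lemma minDigits_apply (i : Fin 3) : minDigits i = ENNReal.ofReal (![1 / 6, 2 / 3, 1 / 6] i) := by
  simp only [minDigits, PMF.ofFintype_apply]

lemma canDigits_two_lt : canDigits 2 < 1 := by
  rw [canDigits_two]; simp

lemma minDigits_two_lt : minDigits 2 < 1 := by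
  rw [minDigits_apply, ← ENNReal.ofReal_one, ENNReal.ofReal_lt_ofReal_iff (by norm_num)]
  change (1 / 6 : ℝ) < 1
  norm_num

lemma minDigits_eq_sq (i : Fin 3) :
    minDigits i = ENNReal.ofReal ((![1, 2, 1] i / Real.sqrt 6) ^ 2) := by
  rw [minDigits_apply, div_pow, Real.sq_sqrt (by norm_num)]
  fin_cases i <;> norm_num

lemma nuCan_compl : nuCan (Set.Ico 0 1)ᶜ = 0 := bernoulliMeasure_compl_Ico _ canDigits_two_lt
lemma nuMin_compl : nuMin (Set.Ico 0 1)ᶜ = 0 := bernoulliMeasure_compl_Ico _ minDigits_two_lt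

lemma nuCan_triadicInterval {n : ℕ} (ε : Fin n → Fin 3) :
    nuCan (triadicInterval ε) = ∏ i, canDigits (ε i) :=
  bernoulliMeasure_triadicInterval _ canDigits_two_lt ε

lemma nuMin_triadicInterval {n : ℕ} (ε : Fin n → Fin 3) :
    nuMin (triadicInterval ε) = ∏ i, minDigits (ε i) :=
  bernoulliMeasure_triadicInterval _ minDigits_two_lt ε

lemma prod_canDigits {n : ℕ} (ε : Fin n → Fin 3) :
    ∏ i, canDigits (ε i) = if ∀ i, ε i = 0 ∨ ε i = 2 then (2⁻¹ : ℝ≥0∞) ^ n else 0 := by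
  split_ifs with h
  · rw [Finset.prod_congr rfl (g := fun _ => (2⁻¹ : ℝ≥0∞)), Finset.prod_const, Finset.card_univ,
      Fintype.card_fin]
    intro i _
    rcases h i with h | h <;> simp [h, canDigits_zero, canDigits_two]
  · push Not at h
    obtain ⟨i, h0, h2⟩ := h
    refine Finset.prod_eq_zero (Finset.mem_univ i) ?_
    have : ε i = 1 := by
      generalize ε i = d at *
      fin_cases d <;> simp_all
    rw [this, canDigits_one]

/-! ### Products of Bernoulli measures and the baker map -/

lemma bernoulliMeasure_prod_eq_sum_left (w : PMF (Fin 3)) (μ : Measure ℝ)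
    [IsProbabilityMeasure μ] :
    (bernoulliMeasure w).prod μ =
      ∑ i : Fin 3, w i • ((bernoulliMeasure w).prod μ).map (Prod.map (contract i) id) := by
  have : ∀ i, ((bernoulliMeasure w).prod μ).map (Prod.map (contract i) id) =
      ((bernoulliMeasure w).map (contract i)).prod μ := fun i => by
    rw [← Measure.map_prod_map _ _ (measurable_contract i) measurable_id, Measure.map_id]
  have hp : ∀ i, IsProbabilityMeasure ((bernoulliMeasure w).map (contract i)) := fun i =>
    Measure.isProbabilityMeasure_map (measurable_contract i).aemeasurable
  conv_lhs => rw [bernoulliMeasure_selfSimilar]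
  simp only [this, Fin.sum_univ_three]
  have hf : ∀ i, IsFiniteMeasure (w i • (bernoulliMeasure w).map (contract i)) := fun i =>
    Measure.smul_finite _ (w.apply_ne_top i)
  rw [Measure.add_prod, Measure.add_prod, Measure.prod_smul_left, Measure.prod_smul_left,
    Measure.prod_smul_left]

lemma bernoulliMeasure_prod_eq_sum_right (w : PMF (Fin 3)) (μ : Measure ℝ)
    [IsProbabilityMeasure μ] :
    μ.prod (bernoulliMeasure w) =
      ∑ i : Fin 3, w i • (μ.prod (bernoulliMeasure w)).map (Prod.map id (contract i)) := by
  have : ∀ i, (μ.prod (bernoulliMeasure w)).map (Prod.map id (contract i)) =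
      μ.prod ((bernoulliMeasure w).map (contract i)) := fun i => by
    rw [← Measure.map_prod_map _ _ measurable_id (measurable_contract i), Measure.map_id]
  have hp : ∀ i, IsProbabilityMeasure ((bernoulliMeasure w).map (contract i)) := fun i =>
    Measure.isProbabilityMeasure_map (measurable_contract i).aemeasurable
  conv_lhs => rw [bernoulliMeasure_selfSimilar]
  simp only [this, Fin.sum_univ_three]
  have hf : ∀ i, IsFiniteMeasure (w i • (bernoulliMeasure w).map (contract i)) := fun i =>
    Measure.smul_finite _ (w.apply_ne_top i)
  rw [Measure.prod_add, Measure.prod_add, Measure.prod_smul_right, Measure.prod_smul_right,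
    Measure.prod_smul_right]

theorem bernoulliMeasure_prod_selfSimilar (w u : PMF (Fin 3)) :
    (bernoulliMeasure w).prod (bernoulliMeasure u) =
      ∑ i : Fin 3, ∑ j : Fin 3, (w i * u j) •
        ((bernoulliMeasure w).prod (bernoulliMeasure u)).map
          (Prod.map (contract i) (contract j)) := by
  conv_lhs => rw [bernoulliMeasure_prod_eq_sum_left]
  refine Finset.sum_congr rfl fun i _ => ?_
  conv_lhs => rw [bernoulliMeasure_prod_eq_sum_right u (bernoulliMeasure w)]
  rw [Measure.map_finset_sum (((measurable_contract i).prodMap measurable_id).aemeasurable),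
    Finset.smul_sum]
  refine Finset.sum_congr rfl fun j _ => ?_
  rw [Measure.map_smul, Measure.map_map ((measurable_contract i).prodMap measurable_id)
    (measurable_id.prodMap (measurable_contract j)), smul_smul]
  rfl

lemma measurable_baker : Measurable baker := by
  unfold baker
  refine Measurable.ite (measurableSet_lt measurable_fst measurable_const) (by fun_prop) ?_
  exact Measurable.ite (measurableSet_lt measurable_fst measurable_const) (by fun_prop)
    (by fun_prop)

lemma measurableSet_hole : MeasurableSet hole := measurableSet_Ico.prod measurableSet_Ico

/-- The baker map is a shift of the two-sided digit string: the leading digit of `q` becomes the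
leading digit of `p`. -/
lemma baker_contract (i : Fin 3) {x : ℝ × ℝ} (hx : x.1 ∈ Set.Ico (0 : ℝ) 1) :
    baker (contract i x.1, x.2) = (x.1, contract i x.2) := by
  obtain ⟨h0, h1⟩ := hx
  fin_cases i
  · have : x.1 / 3 < 3⁻¹ := by linarith
    simp [baker, contract, this]
    ring
  · have h : ¬ (x.1 + 1) / 3 < 3⁻¹ := by linarith
    have h' : (x.1 + 1) / 3 < 2 / 3 := by linarith
    simp [baker, contract, h, h']
    ring
  · have h : ¬ (x.1 + 2) / 3 < 3⁻¹ := by linarith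
    have h' : ¬ (x.1 + 2) / 3 < 2 / 3 := by linarith
    simp [baker, contract, h, h']
    ring

lemma contract_mem_hole_iff (i : Fin 3) {x : ℝ × ℝ} (hx : x ∈ torus) :
    (contract i x.1, x.2) ∈ hole ↔ i = 1 := by
  obtain ⟨⟨h0, h1⟩, h2, h3⟩ := hx
  simp only [hole, Set.mem_prod, Set.mem_Ico, contract, h2, h3, and_true]
  fin_cases i
  · simp
    intro h
    linarith
  · simp
    constructor <;> linarith
  · simp
    intro h
    linarith

section

variable {μ : Measure ℝ} [IsProbabilityMeasure μ]

lemma prod_torus_compl {μ ν : Measure ℝ} [SFinite μ] [SFinite ν] (hμ : μ (Set.Ico 0 1)ᶜ = 0)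
    (hν : ν (Set.Ico 0 1)ᶜ = 0) : μ.prod ν torusᶜ = 0 := by
  rw [torus, Set.compl_prod_eq_union]
  refine measure_union_null ?_ ?_
  · rw [Measure.prod_prod, hμ, zero_mul]
  · rw [Measure.prod_prod, hν, mul_zero]

/-- Condition on the first position digit, which the map turns into the first momentum digit while
it keeps the weight `w i`. The set `D` serves two uses: everything for invariance, the complement of
the hole for the open map. -/
lemma prod_baker_preimage_eq (w u : PMF (Fin 3)) (hw : w 2 < 1) (hu : u 2 < 1)
    {A D : Set (ℝ × ℝ)} (hA : MeasurableSet A) (hD : MeasurableSet D) :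
    (bernoulliMeasure w).prod (bernoulliMeasure u) (baker ⁻¹' A ∩ D) =
      ∑ i, w i * (bernoulliMeasure w).prod (bernoulliMeasure u)
        (Prod.map id (contract i) ⁻¹' A ∩ Prod.map (contract i) id ⁻¹' D) := by
  conv_lhs => rw [bernoulliMeasure_prod_eq_sum_left, Measure.finsetSum_apply]
  refine Finset.sum_congr rfl fun i _ => ?_
  have hT := prod_torus_compl (bernoulliMeasure_compl_Ico w hw) (bernoulliMeasure_compl_Ico u hu)
  rw [Measure.smul_apply, smul_eq_mul, Measure.map_apply
    ((measurable_contract i).prodMap measurable_id) ((measurable_baker hA).inter hD),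
    ← measure_inter_conull hT]
  conv_rhs => rw [← measure_inter_conull hT]
  congr 2
  ext x
  simp only [Set.mem_inter_iff, Set.mem_preimage]
  refine and_congr_left fun hx => and_congr_left fun _ => ?_
  change baker (contract i x.1, x.2) ∈ A ↔ (x.1, contract i x.2) ∈ A
  rw [baker_contract i hx.1]

lemma prod_apply_right (u : PMF (Fin 3)) {A : Set (ℝ × ℝ)} (hA : MeasurableSet A) :
    μ.prod (bernoulliMeasure u) A =
      ∑ i, u i * μ.prod (bernoulliMeasure u) (Prod.map id (contract i) ⁻¹' A) := by
  conv_lhs => rw [bernoulliMeasure_prod_eq_sum_right, Measure.finsetSum_apply]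
  exact Finset.sum_congr rfl fun i _ => by
    rw [Measure.smul_apply, smul_eq_mul, Measure.map_apply
      (measurable_id.prodMap (measurable_contract i)) hA]

end

theorem measurePreserving_baker_rhoMax : MeasurePreserving baker rhoMax rhoMax := by
  refine ⟨measurable_baker, ?_⟩
  ext A hA
  rw [Measure.map_apply measurable_baker hA, rhoMax, nuCan]
  -- Position and momentum digits have the same law, so the moved digit already has the weight that
  -- self-similarity in `p` requires.
  have := prod_baker_preimage_eq _ _ canDigits_two_lt canDigits_two_lt hA MeasurableSet.univ
  rw [Set.inter_univ] at this
  rw [this, prod_apply_right _ hA]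
  simp

theorem isEigenmeasure_rhoMin : IsEigenmeasure (1 / 3) rhoMin := by
  intro A hA
  have hT : rhoMin torusᶜ = 0 := prod_torus_compl nuMin_compl nuCan_compl
  have h := prod_baker_preimage_eq _ _ minDigits_two_lt canDigits_two_lt hA measurableSet_hole.compl
  have h' := prod_apply_right (μ := nuMin) canDigits hA
  change rhoMin _ = ∑ i, _ * rhoMin _ at h
  change rhoMin _ = ∑ i, _ * rhoMin _ at h'
  rw [Set.sdiff_eq, h, h', Finset.mul_sum]
  refine Finset.sum_congr rfl fun i _ => ?_
  rw [← mul_assoc]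
  -- The branch `1` is lost in the hole and has Cantor weight zero. On the other two branches the
  -- eigenvalue is the ratio `(1/6) / (1/2) = 1/3` of the position weight to the momentum weight.
  by_cases hi : i = 1
  · subst hi
    rw [canDigits_one, mul_zero, zero_mul, ← measure_inter_conull hT]
    have : Prod.map id (contract 1) ⁻¹' A ∩ Prod.map (contract 1) id ⁻¹' holeᶜ ∩ torus = ∅ := by
      ext x
      simp only [Set.mem_inter_iff, Set.mem_empty_iff_false, iff_false]
      rintro ⟨⟨-, hx⟩, hxT⟩
      exact hx ((contract_mem_hole_iff 1 hxT).2 rfl)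
    rw [this, measure_empty, mul_zero]
  · have hset : rhoMin (Prod.map id (contract i) ⁻¹' A ∩ Prod.map (contract i) id ⁻¹' holeᶜ) =
        rhoMin (Prod.map id (contract i) ⁻¹' A) := by
      rw [← measure_inter_conull hT, ← measure_inter_conull (s := Prod.map id (contract i) ⁻¹' A) hT]
      congr 1
      ext x
      simp only [Set.mem_inter_iff]
      refine and_congr_left fun hxT => ?_
      refine and_iff_left fun hx => hi ((contract_mem_hole_iff i hxT).1 hx)
    rw [hset]
    congr 1
    have h2 : (2⁻¹ : ℝ≥0∞) = ENNReal.ofReal (1 / 2) := by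
      rw [one_div, ENNReal.ofReal_inv_of_pos (by norm_num)]; simp
    have h3 : (1 / 3 : ℝ≥0∞) = ENNReal.ofReal (1 / 3) := by
      rw [one_div, one_div, ENNReal.ofReal_inv_of_pos (by norm_num)]; simp
    have h6 : ENNReal.ofReal (1 / 6) = 1 / 3 * 2⁻¹ := by
      rw [h2, h3, ← ENNReal.ofReal_mul (by norm_num)]
      norm_num
    rw [minDigits_apply]
    fin_cases i
    · simpa [canDigits_zero] using h6
    · exact absurd rfl hi
    · simpa [canDigits_two] using h6

/-! ### Trapped sets -/

/-- Points of `[0,1)` whose ternary digit number `m` equals `1`. -/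
def middleDigit : ℕ → Set ℝ
  | 0 => Set.Ico (1 / 3) (2 / 3)
  | m + 1 => ⋃ i : Fin 3, contract i '' middleDigit m

lemma contract_mem_Ico (i : Fin 3) {x : ℝ} (hx : x ∈ Set.Ico (0 : ℝ) 1) :
    contract i x ∈ Set.Ico (0 : ℝ) 1 := by
  obtain ⟨h0, h1⟩ := hx
  fin_cases i <;> simp [contract] <;> constructor <;> linarith

lemma middleDigit_subset (m : ℕ) : middleDigit m ⊆ Set.Ico 0 1 := by
  induction m with
  | zero => exact Set.Ico_subset_Ico (by norm_num) (by norm_num)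
  | succ m ih =>
    rw [middleDigit, Set.iUnion_subset_iff]
    rintro i _ ⟨x, hx, rfl⟩
    exact contract_mem_Ico i (ih hx)

lemma eq_of_contract_eq {i j : Fin 3} {x y : ℝ} (hx : x ∈ Set.Ico (0 : ℝ) 1)
    (hy : y ∈ Set.Ico (0 : ℝ) 1) (h : contract i x = contract j y) : i = j ∧ x = y := by
  have h' : x + ((i : ℕ) : ℝ) = y + ((j : ℕ) : ℝ) := by
    simp only [contract] at h
    linarith
  have a1 : ((i : ℕ) : ℝ) < ((j : ℕ) : ℝ) + 1 := by linarith [hx.1, hx.2, hy.1, hy.2]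
  have a2 : ((j : ℕ) : ℝ) < ((i : ℕ) : ℝ) + 1 := by linarith [hx.1, hx.2, hy.1, hy.2]
  norm_cast at a1 a2
  have hij : i = j := by ext; omega
  subst hij
  exact ⟨rfl, by linarith⟩

/-- The digit `1` has Cantor weight zero. Self-similarity carries this from one place to the next,
since prepending a digit to a point of `[0,1)` is injective in both the digit and the point. -/
lemma nuCan_middleDigit (m : ℕ) : nuCan (middleDigit m) = 0 := by
  induction m with
  | zero =>
    have h := nuCan_triadicInterval (fun _ : Fin 1 => (1 : Fin 3))
    have hset : triadicInterval (fun _ : Fin 1 => (1 : Fin 3)) = Set.Ico (1 / 3) (2 / 3) := by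
      simp [triadicInterval]
      norm_num
    rw [hset] at h
    rw [middleDigit, h]
    simp [canDigits_one]
  | succ m ih =>
    rw [middleDigit]
    refine measure_iUnion_null fun i => ?_
    rw [nuCan, bernoulliMeasure_apply]
    refine Finset.sum_eq_zero fun j _ => ?_
    refine mul_eq_zero_of_right _ ?_
    change nuCan _ = 0
    rw [← measure_inter_conull nuCan_compl]
    refine measure_mono_null ?_ ih
    rintro x ⟨⟨y, hy, hyx⟩, hx⟩
    rwa [← (eq_of_contract_eq (middleDigit_subset m hy) hx hyx).2]

lemma baker_snd (x : ℝ × ℝ) : ∃ i : Fin 3, (baker x).2 = contract i x.2 ∧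
    (x ∈ hole → i = 1) := by
  unfold baker
  split_ifs with h1 h2
  · exact ⟨0, by simp [contract], fun h => absurd h.1.1 (not_le.2 h1)⟩
  · exact ⟨1, by simp [contract], fun _ => rfl⟩
  · exact ⟨2, by simp [contract], fun h => absurd h.1.2 h2⟩

/-- A point of the hole has leading position digit `1`. The first step makes it a momentum digit and
each later step pushes it one place further. An inclusion suffices, since only null sets are wanted.
-/
lemma baker_iterate_hole_subset (m : ℕ) :
    baker^[m + 1] '' hole ⊆ Set.univ ×ˢ middleDigit m := by
  induction m with
  | zero =>
    rintro _ ⟨x, hx, rfl⟩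
    obtain ⟨i, hi, hi1⟩ := baker_snd x
    rw [hi1 hx] at hi
    refine ⟨Set.mem_univ _, ?_⟩
    rw [zero_add, Function.iterate_one, hi]
    obtain ⟨-, h0, h1⟩ := hx
    simp only [contract, middleDigit, Set.mem_Ico]
    constructor <;> norm_num <;> linarith
  | succ m ih =>
    rintro _ ⟨x, hx, rfl⟩
    obtain ⟨-, h⟩ := ih ⟨x, hx, rfl⟩
    rw [Function.iterate_succ_apply']
    obtain ⟨i, hi, -⟩ := baker_snd (baker^[m + 1] x)
    refine ⟨Set.mem_univ _, ?_⟩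
    rw [hi]
    exact Set.mem_iUnion.2 ⟨i, _, h, rfl⟩

lemma prod_nuCan_backwardTrapped_compl {μ : Measure ℝ} [IsProbabilityMeasure μ]
    (hμ : μ (Set.Ico 0 1)ᶜ = 0) : μ.prod nuCan backwardTrappedᶜ = 0 := by
  rw [backwardTrapped, Set.sdiff_eq, Set.compl_inter, compl_compl]
  refine measure_union_null (prod_torus_compl hμ nuCan_compl) (measure_iUnion_null fun m => ?_)
  refine measure_mono_null (baker_iterate_hole_subset m) ?_
  rw [Measure.prod_prod, nuCan_middleDigit, mul_zero]

theorem rhoMin_backwardTrapped_compl : rhoMin backwardTrappedᶜ = 0 :=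
  prod_nuCan_backwardTrapped_compl nuMin_compl

theorem rhoMax_repeller_compl : rhoMax repellerᶜ = 0 := by
  rw [repeller, Set.compl_inter]
  refine measure_union_null (prod_nuCan_backwardTrapped_compl nuCan_compl) ?_
  rw [forwardTrapped, Set.sdiff_eq, Set.compl_inter, compl_compl]
  refine measure_union_null (prod_torus_compl nuCan_compl nuCan_compl)
    (measure_iUnion_null fun m => ?_)
  -- By invariance every preimage of the hole is null once the hole itself is.
  rw [(measurePreserving_baker_rhoMax.iterate m).measure_preimage
    measurableSet_hole.nullMeasurableSet, hole, rhoMax, Measure.prod_prod]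
  have := nuCan_middleDigit 0
  rw [middleDigit] at this
  rw [this, zero_mul]

/-! ### Triadic partitions and weak convergence -/

lemma exists_mem_triadicInterval (n : ℕ) {x : ℝ} (hx : x ∈ Set.Ico (0 : ℝ) 1) :
    ∃ ε : Fin n → Fin 3, x ∈ triadicInterval ε := by
  induction n generalizing x with
  | zero => exact ⟨Fin.elim0, by rwa [triadicInterval_zero]⟩
  | succ n ih =>
    obtain ⟨i, hi⟩ : ∃ i : Fin 3, 3 * x - ((i : ℕ) : ℝ) ∈ Set.Ico (0 : ℝ) 1 := by
      obtain ⟨h0, h1⟩ := hx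
      rcases lt_or_ge (3 * x) 1 with h | h
      · exact ⟨0, by constructor <;> norm_num <;> linarith⟩
      rcases lt_or_ge (3 * x) 2 with h' | h'
      · exact ⟨1, by constructor <;> norm_num <;> linarith⟩
      · exact ⟨2, by constructor <;> norm_num <;> linarith⟩
    obtain ⟨ε, hε⟩ := ih hi
    exact ⟨Fin.cons i ε, by simpa [mem_triadicInterval_succ] using hε⟩

lemma triadicInterval_unique {n : ℕ} {ε ε' : Fin n → Fin 3} {x : ℝ}
    (h : x ∈ triadicInterval ε) (h' : x ∈ triadicInterval ε') : ε = ε' := by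
  induction n generalizing x with
  | zero => exact Subsingleton.elim _ _
  | succ n ih =>
    rw [mem_triadicInterval_succ] at h h'
    have hx := triadicInterval_subset_Ico _ h
    have hx' := triadicInterval_subset_Ico _ h'
    obtain ⟨h0, heq⟩ := eq_of_contract_eq (i := ε 0) (j := ε' 0) hx hx' (by
      simp only [contract]; ring)
    rw [← heq] at h'
    rw [← Fin.cons_self_tail ε, ← Fin.cons_self_tail ε', h0, ih h h']

lemma triadicInterval_subset_castLE {v b : ℕ} (hvb : v ≤ b) (ε : Fin b → Fin 3) :
    triadicInterval ε ⊆ triadicInterval (fun i : Fin v => ε (Fin.castLE hvb i)) := by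
  induction v generalizing b with
  | zero => rw [triadicInterval_zero]; exact triadicInterval_subset_Ico ε
  | succ v ih =>
    obtain ⟨b, rfl⟩ : ∃ c, b = c + 1 := ⟨b - 1, by omega⟩
    intro x hx
    rw [mem_triadicInterval_succ] at hx ⊢
    have h := ih (Nat.le_of_succ_le_succ hvb) _ hx
    have h0 : ε (Fin.castLE hvb 0) = ε 0 := rfl
    have ht : Fin.tail (fun i : Fin (v + 1) => ε (Fin.castLE hvb i)) =
        fun i : Fin v => Fin.tail ε (Fin.castLE (Nat.le_of_succ_le_succ hvb) i) := rfl
    rw [ht, h0]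
    exact h

lemma mem_triadicInterval_iff_castLE {v b : ℕ} (hvb : v ≤ b) {ε : Fin b → Fin 3}
    {δ : Fin v → Fin 3} {x : ℝ} (hx : x ∈ triadicInterval ε) :
    x ∈ triadicInterval δ ↔ ∀ i : Fin v, ε (Fin.castLE hvb i) = δ i := by
  have h := triadicInterval_subset_castLE hvb ε hx
  constructor
  · intro h' i
    exact congrFun (triadicInterval_unique h h') i
  · intro h'
    rwa [← funext h']

lemma measurableSet_triadicInterval {b : ℕ} (ε : Fin b → Fin 3) :
    MeasurableSet (triadicInterval ε) := measurableSet_Ico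

lemma measurableSet_rectangle {b b' : ℕ} (ε' : Fin b' → Fin 3) (ε : Fin b → Fin 3) :
    MeasurableSet (rectangle ε' ε) :=
  (measurableSet_triadicInterval ε).prod (measurableSet_triadicInterval ε')

lemma rectangle_subset_torus {b b' : ℕ} (ε' : Fin b' → Fin 3) (ε : Fin b → Fin 3) :
    rectangle ε' ε ⊆ torus :=
  Set.prod_mono (triadicInterval_subset_Ico ε) (triadicInterval_subset_Ico ε')

lemma rectangle_zero (ε' ε : Fin 0 → Fin 3) : rectangle ε' ε = torus := by
  rw [rectangle, triadicInterval_zero, triadicInterval_zero, torus]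

/-- Left endpoint of a triadic interval. -/
def leftEnd {b : ℕ} (ε : Fin b → Fin 3) : ℝ := ∑ i, ((ε i : ℕ) : ℝ) / 3 ^ ((i : ℕ) + 1)

lemma leftEnd_mem {b : ℕ} (ε : Fin b → Fin 3) : leftEnd ε ∈ triadicInterval ε :=
  ⟨le_rfl, lt_add_of_pos_right _ (by positivity)⟩

lemma abs_sub_leftEnd_lt {b : ℕ} {ε : Fin b → Fin 3} {x : ℝ} (hx : x ∈ triadicInterval ε) :
    |x - leftEnd ε| < 1 / 3 ^ b := by
  obtain ⟨h1, h2⟩ := hx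
  rw [leftEnd, abs_lt]
  constructor <;> linarith [show (0 : ℝ) < 1 / 3 ^ b by positivity]

/-- Value at `x` of the step function that is constant on `v`-squares and agrees with `f` at
their lower left corners. -/
def stepApprox (f : ℝ × ℝ → ℝ) (v : ℕ) (x : ℝ × ℝ) : ℝ :=
  ∑ ε' : Fin v → Fin 3, ∑ ε : Fin v → Fin 3,
    (rectangle ε' ε).indicator (fun _ => f (leftEnd ε, leftEnd ε')) x

lemma stepApprox_eq {f : ℝ × ℝ → ℝ} {v : ℕ} {x : ℝ × ℝ} {ε' ε : Fin v → Fin 3}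
    (hx : x ∈ rectangle ε' ε) : stepApprox f v x = f (leftEnd ε, leftEnd ε') := by
  rw [stepApprox, Finset.sum_eq_single ε', Finset.sum_eq_single ε]
  · exact Set.indicator_of_mem hx _
  · intro δ _ hδ
    exact Set.indicator_of_notMem (fun h => hδ (triadicInterval_unique h.1 hx.1)) _
  · simp
  · intro δ' _ hδ'
    refine Finset.sum_eq_zero fun δ _ => ?_
    exact Set.indicator_of_notMem (fun h => hδ' (triadicInterval_unique h.2 hx.2)) _
  · simp

lemma integrable_stepApprox (f : ℝ × ℝ → ℝ) (v : ℕ) (μ : Measure (ℝ × ℝ)) [IsFiniteMeasure μ] :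
    Integrable (stepApprox f v) μ := by
  unfold stepApprox
  exact integrable_finsetSum _ fun _ _ => integrable_finsetSum _ fun _ _ =>
    (integrable_const _).indicator (measurableSet_rectangle _ _)

lemma integral_stepApprox (f : ℝ × ℝ → ℝ) (v : ℕ) (μ : Measure (ℝ × ℝ)) [IsFiniteMeasure μ] :
    ∫ x, stepApprox f v x ∂μ = ∑ ε' : Fin v → Fin 3, ∑ ε : Fin v → Fin 3,
      μ.real (rectangle ε' ε) * f (leftEnd ε, leftEnd ε') := by
  unfold stepApprox
  rw [integral_finsetSum]
  · refine Finset.sum_congr rfl fun ε' _ => ?_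
    rw [integral_finsetSum]
    · refine Finset.sum_congr rfl fun ε _ => ?_
      rw [integral_indicator_const _ (measurableSet_rectangle _ _), smul_eq_mul]
    · exact fun _ _ => (integrable_const _).indicator (measurableSet_rectangle _ _)
  · exact fun _ _ => integrable_finsetSum _ fun _ _ =>
      (integrable_const _).indicator (measurableSet_rectangle _ _)

lemma exists_stepApprox_close {f : ℝ × ℝ → ℝ} (hf : Continuous f) {η : ℝ} (hη : 0 < η) :
    ∃ v, ∀ x ∈ torus, |f x - stepApprox f v x| ≤ η := by
  have hK : IsCompact (Set.Icc (0 : ℝ) 1 ×ˢ Set.Icc (0 : ℝ) 1) := isCompact_Icc.prod isCompact_Icc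
  have hu := hK.uniformContinuousOn_of_continuous hf.continuousOn
  rw [Metric.uniformContinuousOn_iff] at hu
  obtain ⟨δ, hδ, hu⟩ := hu η hη
  obtain ⟨v, hv⟩ := exists_pow_lt_of_lt_one hδ (show (1 / 3 : ℝ) < 1 by norm_num)
  refine ⟨v, fun x hx => ?_⟩
  obtain ⟨ε, hε⟩ := exists_mem_triadicInterval v hx.1
  obtain ⟨ε', hε'⟩ := exists_mem_triadicInterval v hx.2
  rw [stepApprox_eq (ε' := ε') (ε := ε) ⟨hε, hε'⟩]
  have hsub : Set.Ico (0 : ℝ) 1 ⊆ Set.Icc 0 1 := Set.Ico_subset_Icc_self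
  have h := hu x ⟨hsub hx.1, hsub hx.2⟩ (leftEnd ε, leftEnd ε')
    ⟨hsub (triadicInterval_subset_Ico _ (leftEnd_mem ε)),
      hsub (triadicInterval_subset_Ico _ (leftEnd_mem ε'))⟩ ?_
  · exact h.le
  · rw [one_div_pow] at hv
    rw [Prod.dist_eq, max_lt_iff]
    exact ⟨(abs_sub_leftEnd_lt hε).trans hv, (abs_sub_leftEnd_lt hε').trans hv⟩

lemma integrable_of_continuous_of_torus {f : ℝ × ℝ → ℝ} (hf : Continuous f) (μ : Measure (ℝ × ℝ))
    [IsFiniteMeasure μ] (hμ : μ torusᶜ = 0) : Integrable f μ := by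
  obtain ⟨C, hC⟩ := ((isCompact_Icc (a := (0 : ℝ)) (b := 1)).prod
    (isCompact_Icc (a := (0 : ℝ)) (b := 1))).exists_bound_of_continuousOn hf.continuousOn
  refine Integrable.of_bound hf.aestronglyMeasurable C ?_
  filter_upwards [compl_mem_ae_iff.2 hμ] with x hx
  rw [compl_compl] at hx
  exact hC x ⟨Set.Ico_subset_Icc_self hx.1, Set.Ico_subset_Icc_self hx.2⟩

lemma abs_integral_sub_stepApprox_le {f : ℝ × ℝ → ℝ} (hf : Continuous f) {η : ℝ} {v : ℕ}
    (hv : ∀ x ∈ torus, |f x - stepApprox f v x| ≤ η) (μ : Measure (ℝ × ℝ))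
    [IsFiniteMeasure μ] (hμ : μ torusᶜ = 0) :
    |∫ x, f x ∂μ - ∫ x, stepApprox f v x ∂μ| ≤ η * μ.real Set.univ := by
  rw [← integral_sub (integrable_of_continuous_of_torus hf μ hμ) (integrable_stepApprox f v μ)]
  rw [← Real.norm_eq_abs]
  refine norm_integral_le_of_norm_le_const (μ := μ) ?_
  filter_upwards [compl_mem_ae_iff.2 hμ] with x hx
  rw [compl_compl] at hx
  exact hv x hx

theorem ConvergesOnSquares.convergesWeakStar {μ : ℕ → Measure (ℝ × ℝ)} {ρ : Measure (ℝ × ℝ)}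
    [∀ n, IsFiniteMeasure (μ n)] [IsFiniteMeasure ρ] (hμ : ∀ n, μ n torusᶜ = 0)
    (hρ : ρ torusᶜ = 0) (h : ConvergesOnSquares μ ρ) : ConvergesWeakStar μ ρ := by
  intro f hf
  have hreal : ∀ (v : ℕ) (ε' ε : Fin v → Fin 3),
      Tendsto (fun n => (μ n).real (rectangle ε' ε)) atTop (𝓝 (ρ.real (rectangle ε' ε))) :=
    fun v ε' ε => (ENNReal.tendsto_toReal (measure_ne_top _ _)).comp (h v ε' ε)
  -- The single square with `v = 0` is the whole torus, so convergence on squares includes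
  -- convergence of the total mass.
  have huniv : ∀ ν : Measure (ℝ × ℝ), ν torusᶜ = 0 →
      ν.real Set.univ = ν.real (rectangle (Fin.elim0 : Fin 0 → Fin 3) Fin.elim0) := by
    intro ν hν
    rw [rectangle_zero, Measure.real, Measure.real, ← measure_inter_conull hν, Set.univ_inter]
  have hmass : Tendsto (fun n => (μ n).real Set.univ) atTop (𝓝 (ρ.real Set.univ)) := by
    simp only [huniv _ (hμ _), huniv _ hρ]
    exact hreal 0 _ _
  rw [Metric.tendsto_atTop]
  intro η hη
  set m := ρ.real Set.univ with hm
  have hm0 : 0 ≤ m := measureReal_nonneg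
  -- In the limit the two approximation errors add up to `2 κ m`, which is strictly below `κ (2 m +
  -- 2) = η`, also when `m = 0`.
  let κ := η / (2 * m + 2)
  have hκ : 0 < κ := by positivity
  obtain ⟨v, hv⟩ := exists_stepApprox_close hf hκ
  have hstep : Tendsto (fun n => ∫ x, stepApprox f v x ∂(μ n)) atTop
      (𝓝 (∫ x, stepApprox f v x ∂ρ)) := by
    simp only [integral_stepApprox]
    exact tendsto_finsetSum _ fun ε' _ => tendsto_finsetSum _ fun ε _ =>
      (hreal v ε' ε).mul_const _
  have hlim : Tendsto (fun n => κ * (μ n).real Set.univ +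
      |∫ x, stepApprox f v x ∂(μ n) - ∫ x, stepApprox f v x ∂ρ| + κ * m) atTop
      (𝓝 (κ * m + |∫ x, stepApprox f v x ∂ρ - ∫ x, stepApprox f v x ∂ρ| + κ * m)) :=
    ((hmass.const_mul κ).add (hstep.sub_const _).abs).add_const _
  have hlt : κ * m + |∫ x, stepApprox f v x ∂ρ - ∫ x, stepApprox f v x ∂ρ| + κ * m < η := by
    rw [sub_self, abs_zero, add_zero]
    have : κ * (2 * m + 2) = η := div_mul_cancel₀ _ (by positivity)
    linarith
  obtain ⟨N, hN⟩ := eventually_atTop.1 (hlim.eventually_lt_const hlt)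
  refine ⟨N, fun n hn => lt_of_le_of_lt ?_ (hN n hn)⟩
  rw [Real.dist_eq]
  have h1 := abs_integral_sub_stepApprox_le hf hv (μ n) (hμ n)
  have h2 := abs_integral_sub_stepApprox_le hf hv ρ hρ
  rw [abs_sub_comm] at h2
  calc _ = |(∫ x, f x ∂(μ n) - ∫ x, stepApprox f v x ∂(μ n)) +
        (∫ x, stepApprox f v x ∂(μ n) - ∫ x, stepApprox f v x ∂ρ) +
        (∫ x, stepApprox f v x ∂ρ - ∫ x, f x ∂ρ)| := by congr 1; ring
    _ ≤ _ := (abs_add_three _ _ _).trans (by gcongr)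

/-- Finite measures on the torus are determined by their values on squares. -/
theorem eq_of_forall_square {μ ρ : Measure (ℝ × ℝ)} [IsFiniteMeasure μ] [IsFiniteMeasure ρ]
    (hμ : μ torusᶜ = 0) (hρ : ρ torusᶜ = 0)
    (h : ∀ (v : ℕ) (ε' ε : Fin v → Fin 3), μ (rectangle ε' ε) = ρ (rectangle ε' ε)) : μ = ρ := by
  refine ext_of_forall_integral_eq_of_IsFiniteMeasure fun f => ?_
  -- The constant sequence `μ` converges weakly both to `ρ` and to itself.
  have hc : ConvergesOnSquares (fun _ => μ) ρ := fun v ε' ε => by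
    simpa only [h v ε' ε] using tendsto_const_nhds
  exact tendsto_nhds_unique tendsto_const_nhds
    (hc.convergesWeakStar (fun _ => hμ) hρ f f.continuous)

/-- Limits on squares are unique among measures on the torus. -/
theorem ConvergesOnSquares.unique {μ : ℕ → Measure (ℝ × ℝ)} {ρ ρ' : Measure (ℝ × ℝ)}
    [IsFiniteMeasure ρ] (hρ : ρ torusᶜ = 0) (hρ' : ρ' torusᶜ = 0) (h : ConvergesOnSquares μ ρ)
    (h' : ConvergesOnSquares μ ρ') : ρ' = ρ := by
  have heq : ∀ (v : ℕ) (ε' ε : Fin v → Fin 3), ρ' (rectangle ε' ε) = ρ (rectangle ε' ε) :=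
    fun v ε' ε => tendsto_nhds_unique (h' v ε' ε) (h v ε' ε)
  -- Finiteness of `ρ'` is not assumed; it follows from agreement with `ρ` on the square with `v =
  -- 0`.
  have hfin : IsFiniteMeasure ρ' := ⟨by
    rw [← measure_inter_conull hρ', Set.univ_inter,
      ← rectangle_zero Fin.elim0 Fin.elim0, heq]
    exact measure_lt_top _ _⟩
  exact eq_of_forall_square hρ' hρ heq

/-! ### Values of Walsh-Husimi measures on squares -/

lemma volume_rectangle {b b' : ℕ} (ε' : Fin b' → Fin 3) (ε : Fin b → Fin 3) :
    volume (rectangle ε' ε) = ENNReal.ofReal (1 / 3 ^ b) * ENNReal.ofReal (1 / 3 ^ b') := by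
  rw [rectangle, Measure.volume_eq_prod, Measure.prod_prod, triadicInterval, triadicInterval,
    Real.volume_Ico, Real.volume_Ico, add_sub_cancel_left, add_sub_cancel_left]

lemma volume_rectangle_ne_zero {b b' : ℕ} (ε' : Fin b' → Fin 3) (ε : Fin b → Fin 3) :
    volume (rectangle ε' ε) ≠ 0 := by
  rw [volume_rectangle]
  refine mul_ne_zero ?_ ?_ <;> exact (ENNReal.ofReal_pos.2 (by positivity)).ne'

lemma volume_rectangle_ne_top {b b' : ℕ} (ε' : Fin b' → Fin 3) (ε : Fin b → Fin 3) :
    volume (rectangle ε' ε) ≠ ∞ := by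
  rw [volume_rectangle]
  exact ENNReal.mul_ne_top ENNReal.ofReal_ne_top ENNReal.ofReal_ne_top

lemma cond_rectangle_of_subset {b b' : ℕ} (ε' : Fin b' → Fin 3) (ε : Fin b → Fin 3)
    {A : Set (ℝ × ℝ)} (hA : rectangle ε' ε ⊆ A) :
    ProbabilityTheory.cond volume (rectangle ε' ε) A = 1 := by
  rw [ProbabilityTheory.cond_apply (measurableSet_rectangle _ _), Set.inter_eq_left.2 hA,
    ENNReal.inv_mul_cancel (volume_rectangle_ne_zero _ _) (volume_rectangle_ne_top _ _)]

lemma cond_rectangle_of_disjoint {b b' : ℕ} (ε' : Fin b' → Fin 3) (ε : Fin b → Fin 3)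
    {A : Set (ℝ × ℝ)} (hA : Disjoint (rectangle ε' ε) A) :
    ProbabilityTheory.cond volume (rectangle ε' ε) A = 0 := by
  rw [ProbabilityTheory.cond_apply (measurableSet_rectangle _ _), hA.inter_eq, measure_empty,
    mul_zero]

-- Triadic rectangles are nested or disjoint, so a quantum rectangle that is at least as fine as the
-- square in both directions never meets it partially.
open Classical in
lemma cond_rectangle_rectangle {v b b' : ℕ} (hb : v ≤ b) (hb' : v ≤ b') (ε' : Fin b' → Fin 3)
    (ε : Fin b → Fin 3) (δ' δ : Fin v → Fin 3) :
    ProbabilityTheory.cond volume (rectangle ε' ε) (rectangle δ' δ) =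
      if (∀ i, ε' (Fin.castLE hb' i) = δ' i) ∧ ∀ i, ε (Fin.castLE hb i) = δ i then 1 else 0 := by
  split_ifs with h
  · refine cond_rectangle_of_subset _ _ fun x hx => ⟨?_, ?_⟩
    · exact (mem_triadicInterval_iff_castLE hb hx.1).2 h.2
    · exact (mem_triadicInterval_iff_castLE hb' hx.2).2 h.1
  · refine cond_rectangle_of_disjoint _ _ (Set.disjoint_left.2 fun x hx hx' => h ⟨?_, ?_⟩)
    · exact (mem_triadicInterval_iff_castLE hb' hx.2).1 hx'.2
    · exact (mem_triadicInterval_iff_castLE hb hx.1).1 hx'.1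

lemma husimi_apply (k b : ℕ) (ψ : QState k) (A : Set (ℝ × ℝ)) :
    husimi k b ψ A = ∑ ε' : Fin (k - b) → Fin 3, ∑ ε : Fin b → Fin 3,
      ENNReal.ofReal (husimiWeight k b ψ ε' ε) *
        ProbabilityTheory.cond volume (rectangle ε' ε) A := by
  simp only [husimi, Measure.finsetSum_apply, Measure.smul_apply, smul_eq_mul]

lemma husimi_torus_compl (k b : ℕ) (ψ : QState k) : husimi k b ψ torusᶜ = 0 := by
  rw [husimi_apply]
  refine Finset.sum_eq_zero fun ε' _ => Finset.sum_eq_zero fun ε _ => ?_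
  rw [cond_rectangle_of_disjoint, mul_zero]
  exact Set.disjoint_compl_right_iff_subset.2 (rectangle_subset_torus ε' ε)

instance isFiniteMeasure_husimi (k b : ℕ) (ψ : QState k) : IsFiniteMeasure (husimi k b ψ) := ⟨by
  rw [husimi_apply]
  refine ENNReal.sum_lt_top.2 fun ε' _ => ENNReal.sum_lt_top.2 fun ε _ => ?_
  rw [cond_rectangle_of_subset _ _ (Set.subset_univ _), mul_one]
  exact ENNReal.ofReal_lt_top⟩

open Classical in
lemma husimi_rectangle {k b v : ℕ} (hb : v ≤ b) (hb' : v ≤ k - b) (ψ : QState k)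
    (δ' δ : Fin v → Fin 3) :
    husimi k b ψ (rectangle δ' δ) = ENNReal.ofReal
      (∑ ε' : Fin (k - b) → Fin 3, ∑ ε : Fin b → Fin 3,
        if (∀ i, ε' (Fin.castLE hb' i) = δ' i) ∧ ∀ i, ε (Fin.castLE hb i) = δ i then
          husimiWeight k b ψ ε' ε else 0) := by
  have hw : ∀ ε' ε, 0 ≤ husimiWeight k b ψ ε' ε := fun _ _ => sq_nonneg _
  have h0 : ∀ ε' ε, 0 ≤ (if (∀ i, ε' (Fin.castLE hb' i) = δ' i) ∧
      ∀ i, ε (Fin.castLE hb i) = δ i then husimiWeight k b ψ ε' ε else 0) := by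
    intro ε' ε
    split_ifs
    exacts [hw _ _, le_rfl]
  rw [husimi_apply, ENNReal.ofReal_sum_of_nonneg fun ε' _ => Finset.sum_nonneg fun ε _ => h0 ε' ε]
  refine Finset.sum_congr rfl fun ε' _ => ?_
  rw [ENNReal.ofReal_sum_of_nonneg fun ε _ => h0 ε' ε]
  refine Finset.sum_congr rfl fun ε _ => ?_
  rw [cond_rectangle_rectangle hb hb']
  split_ifs <;> simp

/-! ### Tensor product operators -/

section Tensor

variable {ι : Type*} [Fintype ι]

lemma prod_one_apply (c x : ι → Fin 3) :
    ∏ i, (1 : Matrix (Fin 3) (Fin 3) ℂ) (c i) (x i) = if c = x then 1 else 0 := by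
  split_ifs with h
  · subst h
    simp
  · obtain ⟨i, hi⟩ := Function.ne_iff.1 h
    exact Finset.prod_eq_zero (Finset.mem_univ i) (Matrix.one_apply_ne hi)

variable [DecidableEq ι]

/-- The tensor product of the `3 × 3` matrices `M i`, acting on functions of the digits. -/
def tensorApply (M : ι → Matrix (Fin 3) (Fin 3) ℂ) (ψ : (ι → Fin 3) → ℂ) (c : ι → Fin 3) : ℂ :=
  ∑ x, (∏ i, M i (c i) (x i)) * ψ x

lemma sum_prod_eq_prod_sum {R : Type*} [CommSemiring R] (g : ι → Fin 3 → R) :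
    ∑ x : ι → Fin 3, ∏ i, g i (x i) = ∏ i, ∑ j, g i j := by
  rw [Finset.prod_univ_sum, Fintype.piFinset_univ]

lemma tensorApply_comp (M N : ι → Matrix (Fin 3) (Fin 3) ℂ) (ψ : (ι → Fin 3) → ℂ) :
    tensorApply M (tensorApply N ψ) = tensorApply (fun i => M i * N i) ψ := by
  ext c
  simp only [tensorApply, Finset.mul_sum]
  rw [Finset.sum_comm]
  refine Finset.sum_congr rfl fun y _ => ?_
  simp only [Matrix.mul_apply]
  rw [← sum_prod_eq_prod_sum (fun i j => M i (c i) j * N i j (y i)), Finset.sum_mul]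
  refine Finset.sum_congr rfl fun x _ => ?_
  rw [Finset.prod_mul_distrib, mul_assoc]

lemma tensorApply_one (ψ : (ι → Fin 3) → ℂ) : tensorApply (fun _ => 1) ψ = ψ := by
  ext c
  simp [tensorApply, prod_one_apply]

lemma tensorApply_add (M : ι → Matrix (Fin 3) (Fin 3) ℂ) (ψ φ : (ι → Fin 3) → ℂ) :
    tensorApply M (ψ + φ) = tensorApply M ψ + tensorApply M φ := by
  ext c
  simp [tensorApply, mul_add, Finset.sum_add_distrib]

lemma tensorApply_smul (M : ι → Matrix (Fin 3) (Fin 3) ℂ) (z : ℂ) (ψ : (ι → Fin 3) → ℂ) :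
    tensorApply M (z • ψ) = z • tensorApply M ψ := by
  ext c
  simp [tensorApply, Finset.mul_sum, mul_left_comm]

/-- The same matrix at all sites commutes with permutations of the sites; this is applied to the
cyclic shift. -/
lemma tensorApply_comp_equiv (M : Matrix (Fin 3) (Fin 3) ℂ) (e : ι ≃ ι) (ψ : (ι → Fin 3) → ℂ) :
    tensorApply (fun _ => M) (fun x => ψ (x ∘ e)) =
      fun c => tensorApply (fun _ => M) ψ (c ∘ e) := by
  ext c
  simp only [tensorApply]
  refine Fintype.sum_equiv (Equiv.arrowCongr e.symm (Equiv.refl _)) _ _ fun x => ?_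
  have hx : (Equiv.arrowCongr e.symm (Equiv.refl (Fin 3))) x = x ∘ e := by
    ext i; simp [Equiv.arrowCongr]
  rw [hx]
  congr 1
  exact (Equiv.prod_comp e (fun i => M (c i) (x i))).symm

lemma sum_norm_sq_tensorApply {M : ι → Matrix (Fin 3) (Fin 3) ℂ} (hM : ∀ i, (M i)ᴴ * M i = 1)
    (ψ : (ι → Fin 3) → ℂ) : ∑ c, ‖tensorApply M ψ c‖ ^ 2 = ∑ x, ‖ψ x‖ ^ 2 := by
  have key : ∑ c, star (tensorApply M ψ c) * tensorApply M ψ c = ∑ x, star (ψ x) * ψ x := by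
    have h : tensorApply (fun i => (M i)ᴴ) (tensorApply M ψ) = ψ := by
      rw [tensorApply_comp]
      simp only [hM]
      exact tensorApply_one ψ
    have h' : ∑ x, star (ψ x) * ψ x =
        ∑ x, star (ψ x) * tensorApply (fun i => (M i)ᴴ) (tensorApply M ψ) x := by rw [h]
    rw [h']
    conv_lhs =>
      enter [2, c, 1]
      rw [tensorApply]
    simp only [star_sum, star_mul', star_prod, Finset.sum_mul, tensorApply.eq_1 (fun i => (M i)ᴴ),
      Finset.mul_sum]
    rw [Finset.sum_comm]
    refine Finset.sum_congr rfl fun x _ => Finset.sum_congr rfl fun c _ => ?_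
    simp only [Matrix.conjTranspose_apply]
    ring
  have hsq : ∀ w : ℂ, star w * w = ((‖w‖ ^ 2 : ℝ) : ℂ) := fun w => by
    rw [Complex.star_def, Complex.conj_mul']
    push_cast
    rfl
  simp only [hsq] at key
  exact_mod_cast key

lemma tensorApply_update_one (i : ι) (M : Matrix (Fin 3) (Fin 3) ℂ) (ψ : (ι → Fin 3) → ℂ)
    (c : ι → Fin 3) :
    tensorApply (Function.update (fun _ => 1) i M) ψ c =
      ∑ m, M (c i) m * ψ (Function.update c i m) := by
  have hsplit : ∀ x : ι → Fin 3,
      ∏ j, (Function.update (fun _ => 1) i M : ι → Matrix (Fin 3) (Fin 3) ℂ) j (c j) (x j) =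
        if Function.update c i (x i) = x then M (c i) (x i) else 0 := by
    intro x
    rw [← Finset.mul_prod_erase _ _ (Finset.mem_univ i), Function.update_self]
    split_ifs with h
    · rw [Finset.prod_eq_one, mul_one]
      intro j hj
      have hji := Finset.ne_of_mem_erase hj
      rw [Function.update_of_ne hji, ← congrFun h j, Function.update_of_ne hji, Matrix.one_apply_eq]
    · obtain ⟨j, hj⟩ := Function.ne_iff.1 h
      have hji : j ≠ i := by
        rintro rfl
        simp at hj
      rw [Function.update_of_ne hji] at hj
      rw [Finset.prod_eq_zero (Finset.mem_erase.2 ⟨hji, Finset.mem_univ j⟩), mul_zero]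
      rw [Function.update_of_ne hji, Matrix.one_apply_ne hj]
  simp only [tensorApply, hsplit, ite_mul, zero_mul]
  rw [← Finset.sum_filter]
  refine Finset.sum_nbij' (fun x => x i) (fun m => Function.update c i m) ?_ ?_ ?_ ?_ ?_
  · simp
  · simp
  · intro x hx
    exact (Finset.mem_filter.1 hx).2
  · simp
  · intro x hx
    rw [(Finset.mem_filter.1 hx).2]

/-- The mass that `φ` gives to the configurations equal to `c` on `S`. -/
def cylinderMass (S : Finset ι) (c : ι → Fin 3) (φ : (ι → Fin 3) → ℂ) : ℝ :=
  ∑ x with ∀ i ∈ S, x i = c i, ‖φ x‖ ^ 2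

lemma cylinderMass_nonneg (S : Finset ι) (c : ι → Fin 3) (φ : (ι → Fin 3) → ℂ) :
    0 ≤ cylinderMass S c φ := Finset.sum_nonneg fun _ _ => sq_nonneg _

lemma cylinderMass_le (S : Finset ι) (c : ι → Fin 3) (φ : (ι → Fin 3) → ℂ) :
    cylinderMass S c φ ≤ ∑ x, ‖φ x‖ ^ 2 :=
  Finset.sum_le_sum_of_subset_of_nonneg (Finset.filter_subset _ _) fun _ _ _ => sq_nonneg _

/-- The square root of a mass is a norm, so the triangle inequality controls it under perturbations
of the state. -/
lemma sqrt_cylinderMass (S : Finset ι) (c : ι → Fin 3) (φ : (ι → Fin 3) → ℂ) :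
    Real.sqrt (cylinderMass S c φ) =
      ‖(WithLp.toLp 2 fun x => if ∀ i ∈ S, x i = c i then φ x else 0 :
        EuclideanSpace ℂ (ι → Fin 3))‖ := by
  rw [EuclideanSpace.norm_eq, cylinderMass, Finset.sum_filter]
  congr 1
  refine Finset.sum_congr rfl fun x _ => ?_
  by_cases h : ∀ i ∈ S, x i = c i
  · simp only [if_pos h]
  · simp only [if_neg h]; simp

lemma abs_sqrt_cylinderMass_sub_le (S : Finset ι) (c : ι → Fin 3) (φ χ : (ι → Fin 3) → ℂ) :
    |Real.sqrt (cylinderMass S c (φ + χ)) - Real.sqrt (cylinderMass S c φ)| ≤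
      Real.sqrt (∑ x, ‖χ x‖ ^ 2) := by
  refine le_trans ?_ (Real.sqrt_le_sqrt (cylinderMass_le S c χ))
  simp only [sqrt_cylinderMass]
  refine (abs_norm_sub_norm_le _ _).trans (le_of_eq ?_)
  congr 1
  ext x
  simp only [PiLp.sub_apply, Pi.add_apply]
  split_ifs <;> simp

/-- On a product state on the sites of `S`, a product of unitary matrices produces product
weights. -/
lemma cylinderMass_tensorApply {U : ι → Matrix (Fin 3) (Fin 3) ℂ} (hU : ∀ i, (U i)ᴴ * U i = 1)
    (S : Finset ι) (c s : ι → Fin 3) {Φ : (ι → Fin 3) → ℂ}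
    (hΦ : ∀ η, ¬ (∀ i ∈ S, η i = s i) → Φ η = 0) :
    cylinderMass S c (tensorApply U Φ) =
      (∏ i ∈ S, ‖U i (c i) (s i)‖ ^ 2) * ∑ η, ‖Φ η‖ ^ 2 := by
  -- With the matrices on `S` replaced by the identity, the image of `Φ` still lives on the strings
  -- equal to `s` on `S` and has the same norm. On the cylinder of `c` the true image differs from
  -- it by the constant `∏ U i (c i) (s i)`, after the digits on `S` are exchanged.
  let V : ι → Matrix (Fin 3) (Fin 3) ℂ := fun i => if i ∈ S then 1 else U i
  have hV : ∀ i, (V i)ᴴ * V i = 1 := fun i => by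
    by_cases hi : i ∈ S <;> simp [V, hi, hU]
  have hsupp : ∀ x, ¬ (∀ i ∈ S, x i = s i) → tensorApply V Φ x = 0 := by
    intro x hx
    refine Finset.sum_eq_zero fun η _ => ?_
    by_cases hη : ∀ i ∈ S, η i = s i
    · push Not at hx
      obtain ⟨i, hi, hne⟩ := hx
      rw [Finset.prod_eq_zero (Finset.mem_univ i), zero_mul]
      simp only [V, if_pos hi]
      exact Matrix.one_apply_ne (by rwa [hη i hi])
    · rw [hΦ η hη, mul_zero]
  have hfactor : ∀ x, (∀ i ∈ S, x i = c i) → tensorApply U Φ x =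
      (∏ i ∈ S, U i (c i) (s i)) * tensorApply V Φ (S.piecewise s x) := by
    intro x hx
    rw [tensorApply, tensorApply, Finset.mul_sum]
    refine Finset.sum_congr rfl fun η _ => ?_
    by_cases hη : ∀ i ∈ S, η i = s i
    · rw [← mul_assoc]
      congr 1
      rw [← Finset.prod_mul_prod_compl S, ← Finset.prod_mul_prod_compl S
        (fun i => V i (S.piecewise s x i) (η i))]
      have h1 : ∏ i ∈ S, V i (S.piecewise s x i) (η i) = 1 := by
        refine Finset.prod_eq_one fun i hi => ?_
        simp [V, hi, hη i hi]
      rw [h1, one_mul]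
      congr 1
      · exact Finset.prod_congr rfl fun i hi => by rw [hx i hi, hη i hi]
      · refine Finset.prod_congr rfl fun i hi => ?_
        have hi' := Finset.mem_compl.1 hi
        simp [V, hi']
    · rw [hΦ η hη, mul_zero, mul_zero, mul_zero]
  rw [← sum_norm_sq_tensorApply hV Φ, cylinderMass,
    ← Finset.sum_subset (Finset.filter_subset (fun x => ∀ i ∈ S, x i = s i) Finset.univ)
      (fun x _ hx => by
        rw [hsupp x (fun h => hx (Finset.mem_filter.2 ⟨Finset.mem_univ _, h⟩))]; simp),
    Finset.mul_sum]
  refine Finset.sum_nbij' (fun x => S.piecewise s x) (fun x => S.piecewise c x) ?_ ?_ ?_ ?_ ?_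
  · intro x _
    simp +contextual
  · intro x _
    simp +contextual
  · intro x hx
    have hx := (Finset.mem_filter.1 hx).2
    ext i
    by_cases hi : i ∈ S <;> simp [hi, hx]
  · intro x hx
    have hx := (Finset.mem_filter.1 hx).2
    ext i
    by_cases hi : i ∈ S <;> simp [hi, hx]
  · intro x hx
    rw [hfactor x (Finset.mem_filter.1 hx).2, norm_mul, mul_pow, norm_prod, Finset.prod_pow]

/-- The mass of the configurations whose digit at `i` is not `s`. -/
def defectMass (a : (ι → Fin 3) → ℂ) (i : ι) (s : Fin 3) : ℝ :=
  ∑ η with η i ≠ s, ‖a η‖ ^ 2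

lemma defectMass_nonneg (a : (ι → Fin 3) → ℂ) (i : ι) (s : Fin 3) : 0 ≤ defectMass a i s :=
  Finset.sum_nonneg fun _ _ => sq_nonneg _

lemma sum_not_forall_le_sum_defectMass (a : (ι → Fin 3) → ℂ) (S : Finset ι) (s : Fin 3) :
    ∑ η with ¬ ∀ i ∈ S, η i = s, ‖a η‖ ^ 2 ≤ ∑ i ∈ S, defectMass a i s := by
  simp only [defectMass, Finset.sum_filter]
  rw [Finset.sum_comm]
  refine Finset.sum_le_sum fun η _ => ?_
  have hnn : ∀ i ∈ S, 0 ≤ (if η i ≠ s then ‖a η‖ ^ 2 else 0) := fun i _ => by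
    split_ifs
    exacts [sq_nonneg _, le_rfl]
  by_cases h : ∀ i ∈ S, η i = s
  · rw [if_neg (not_not.2 h)]
    exact Finset.sum_nonneg hnn
  · rw [if_pos h]
    push Not at h
    obtain ⟨i, hi, hne⟩ := h
    refine le_trans (le_of_eq ?_) (Finset.single_le_sum hnn hi)
    rw [if_pos hne]

/-- If `a` is concentrated on configurations equal to `s` on `S`, then the cylinder weights of
its image under a product of unitary matrices are nearly product weights. -/
lemma exists_abs_sqrt_cylinderMass_tensorApply_le {U : ι → Matrix (Fin 3) (Fin 3) ℂ}
    (hU : ∀ i, (U i)ᴴ * U i = 1) (S : Finset ι) (c : ι → Fin 3) (s : Fin 3)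
    {a : (ι → Fin 3) → ℂ} (ha : ∑ η, ‖a η‖ ^ 2 = 1) :
    ∃ r, 0 ≤ r ∧ r ≤ 1 ∧ r ≤ ∑ i ∈ S, defectMass a i s ∧
      |Real.sqrt (cylinderMass S c (tensorApply U a)) -
        Real.sqrt ((∏ i ∈ S, ‖U i (c i) s‖ ^ 2) * (1 - r))| ≤ Real.sqrt r := by
  let Φ : (ι → Fin 3) → ℂ := fun η => if ∀ i ∈ S, η i = s then a η else 0
  let R : (ι → Fin 3) → ℂ := fun η => if ∀ i ∈ S, η i = s then 0 else a η
  have hsum : a = Φ + R := by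
    ext η
    simp only [Φ, R, Pi.add_apply]
    split_ifs <;> simp
  have hR : ∑ η, ‖R η‖ ^ 2 = ∑ η with ¬ ∀ i ∈ S, η i = s, ‖a η‖ ^ 2 := by
    rw [Finset.sum_filter]
    refine Finset.sum_congr rfl fun η _ => ?_
    simp only [R]
    split_ifs <;> simp
  have hΦ : ∑ η, ‖Φ η‖ ^ 2 = 1 - ∑ η, ‖R η‖ ^ 2 := by
    rw [← ha, ← Finset.sum_sub_distrib]
    refine Finset.sum_congr rfl fun η _ => ?_
    simp only [R, Φ]
    split_ifs <;> simp
  refine ⟨∑ η, ‖R η‖ ^ 2, Finset.sum_nonneg fun _ _ => sq_nonneg _,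
    sub_nonneg.1 (hΦ ▸ Finset.sum_nonneg fun _ _ => sq_nonneg _),
    hR.trans_le (sum_not_forall_le_sum_defectMass a S s), ?_⟩
  have h := abs_sqrt_cylinderMass_sub_le S c (tensorApply U Φ) (tensorApply U R)
  rw [← tensorApply_add, ← hsum, sum_norm_sq_tensorApply hU,
    cylinderMass_tensorApply hU S c (fun _ => s) (fun η hη => if_neg hη), hΦ] at h
  exact h

lemma abs_cylinderMass_tensorApply_sub_le {U : ι → Matrix (Fin 3) (Fin 3) ℂ}
    (hU : ∀ i, (U i)ᴴ * U i = 1) (S : Finset ι) (c : ι → Fin 3) (s : Fin 3)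
    {a : (ι → Fin 3) → ℂ} (ha : ∑ η, ‖a η‖ ^ 2 = 1) {D : ℝ}
    (hD : ∑ i ∈ S, defectMass a i s ≤ D) :
    |cylinderMass S c (tensorApply U a) - ∏ i ∈ S, ‖U i (c i) s‖ ^ 2| ≤
      3 * Real.sqrt D + (∏ i ∈ S, ‖U i (c i) s‖ ^ 2) * D := by
  obtain ⟨r, hr0, hr1, hrD, h⟩ := exists_abs_sqrt_cylinderMass_tensorApply_le hU S c s ha
  have hrD := hrD.trans hD
  set W := ∏ i ∈ S, ‖U i (c i) s‖ ^ 2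
  have hW : 0 ≤ W := Finset.prod_nonneg fun _ _ => sq_nonneg _
  set m := cylinderMass S c (tensorApply U a)
  have hm0 : 0 ≤ m := cylinderMass_nonneg _ _ _
  have hm1 : m ≤ 1 := (cylinderMass_le _ _ _).trans_eq ((sum_norm_sq_tensorApply hU a).trans ha)
  have hx := Real.sq_sqrt hm0
  have hy := Real.sq_sqrt (mul_nonneg hW (sub_nonneg.2 hr1))
  set x := Real.sqrt m
  set y := Real.sqrt (W * (1 - r))
  have hx0 : 0 ≤ x := Real.sqrt_nonneg _
  have hy0 : 0 ≤ y := Real.sqrt_nonneg _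
  have hx1 : x ≤ 1 := Real.sqrt_le_one.2 hm1
  have hs1 : Real.sqrt r ≤ 1 := Real.sqrt_le_one.2 hr1
  -- Here `y ≤ x + √r ≤ 2`, without any bound on `W`; hence `x + y ≤ 3` below.
  have hy2 : y ≤ 2 := by linarith [(abs_le.1 h).1]
  have hxy : |x ^ 2 - y ^ 2| ≤ 3 * Real.sqrt r := by
    rw [sq_sub_sq, abs_mul, abs_of_nonneg (add_nonneg hx0 hy0)]
    exact mul_le_mul (by linarith) h (abs_nonneg _) (by norm_num)
  have hWr : |y ^ 2 - W| ≤ W * D := by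
    rw [hy, show W * (1 - r) - W = -(W * r) by ring, abs_neg, abs_of_nonneg (mul_nonneg hW hr0)]
    gcongr
  calc |m - W| = |(x ^ 2 - y ^ 2) + (y ^ 2 - W)| := by rw [hx]; congr 1; ring
    _ ≤ |x ^ 2 - y ^ 2| + |y ^ 2 - W| := abs_add_le _ _
    _ ≤ 3 * Real.sqrt r + W * D := add_le_add hxy hWr
    _ ≤ _ := by gcongr

end Tensor

/-! ### The one-site matrices -/

/-- `1 / √3` as a complex number. -/
def invSqrtThree : ℂ := ((Real.sqrt 3)⁻¹ : ℝ)

/-- `1 / √2` as a complex number. -/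
def invSqrtTwo : ℂ := ((Real.sqrt 2)⁻¹ : ℝ)

lemma invSqrtThree_sq : invSqrtThree ^ 2 = 1 / 3 := by
  rw [invSqrtThree, ← Complex.ofReal_pow, inv_pow, Real.sq_sqrt (by norm_num)]
  norm_num

lemma invSqrtTwo_sq : invSqrtTwo ^ 2 = 1 / 2 := by
  rw [invSqrtTwo, ← Complex.ofReal_pow, inv_pow, Real.sq_sqrt (by norm_num)]
  norm_num

lemma star_invSqrtThree : star invSqrtThree = invSqrtThree := Complex.conj_ofReal _

lemma star_invSqrtTwo : star invSqrtTwo = invSqrtTwo := Complex.conj_ofReal _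

lemma norm_invSqrtThree_sq : ‖invSqrtThree‖ ^ 2 = 1 / 3 := by
  rw [← norm_pow, invSqrtThree_sq]; norm_num

lemma norm_invSqrtTwo_sq : ‖invSqrtTwo‖ ^ 2 = 1 / 2 := by
  rw [← norm_pow, invSqrtTwo_sq]; norm_num

lemma exp_neg_pi_div_six : Complex.exp (-(Real.pi / 6) * Complex.I) =
    (3 * invSqrtThree - Complex.I) / 2 := by
  have h3 : (3 * invSqrtThree : ℂ) = (Real.sqrt 3 : ℝ) := by
    rw [invSqrtThree]
    have : (3 : ℝ) * (Real.sqrt 3)⁻¹ = Real.sqrt 3 := by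
      rw [← div_eq_mul_inv, Real.div_sqrt]
    exact_mod_cast this
  have : (-(Real.pi / 6) : ℂ) = ((-(Real.pi / 6) : ℝ) : ℂ) := by push_cast; rfl
  rw [Complex.exp_mul_I, this, ← Complex.ofReal_cos, ← Complex.ofReal_sin, Real.cos_neg,
    Real.sin_neg, Real.cos_pi_div_six, Real.sin_pi_div_six, h3]
  push_cast
  ring

/-- The phase is `-(π/6)(2n+1)(2m+1)`. Everything is expressed through `1/√3` and `i`, so later
matrix identities are polynomial identities modulo the squares of these numbers. -/
lemma F3_eq_pow (n m : Fin 3) : F3 n m = invSqrtThree *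
    ((3 * invSqrtThree - Complex.I) / 2) ^ ((2 * (n : ℕ) + 1) * (2 * (m : ℕ) + 1)) := by
  rw [← exp_neg_pi_div_six, ← Complex.exp_nat_mul, F3, Matrix.of_apply, invSqrtThree]
  push_cast
  congr 2
  ring

lemma F3_eq : F3 = !![(1 - invSqrtThree * Complex.I) / 2, -(invSqrtThree * Complex.I),
      (-1 - invSqrtThree * Complex.I) / 2;
    -(invSqrtThree * Complex.I), invSqrtThree * Complex.I, -(invSqrtThree * Complex.I);
    (-1 - invSqrtThree * Complex.I) / 2, -(invSqrtThree * Complex.I),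
      (1 - invSqrtThree * Complex.I) / 2] := by
  have hb := invSqrtThree_sq
  have hI := Complex.I_sq
  set w := (3 * invSqrtThree - Complex.I) / 2 with hw
  -- The exponents `(2n+1)(2m+1)` that occur are `1, 3, 5, 9, 15, 25`, and `w` is a twelfth root of
  -- unity.
  have h3 : w ^ 3 = -Complex.I := by
    rw [hw]; grind
  have h5 : w ^ 5 = (-(3 * invSqrtThree) - Complex.I) / 2 := by
    rw [show w ^ 5 = w ^ 3 * w ^ 2 by ring, h3, hw]; grind
  have h9 : w ^ 9 = Complex.I := by
    rw [show w ^ 9 = (w ^ 3) ^ 3 by ring, h3]; grind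
  have h15 : w ^ 15 = -Complex.I := by
    rw [show w ^ 15 = w ^ 9 * (w ^ 3) ^ 2 by ring, h3, h9]; grind
  have h25 : w ^ 25 = w := by
    rw [show w ^ 25 = w ^ 15 * w ^ 9 * w by ring, h15, h9]; grind
  have h (n m : Fin 3) := F3_eq_pow n m
  rw [← hw] at h
  ext n m
  rw [h]
  fin_cases n <;> fin_cases m <;> simp [h3, h5, h9, h15, h25] <;> grind

/-- The one-site matrix `F₃^† π`, `π = diag(1, 0, 1)`. -/
def siteMatrix : Matrix (Fin 3) (Fin 3) ℂ :=
  Matrix.of fun n m => if m = 1 then 0 else F3ᴴ n m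

/-- Orthonormal basis (as rows): the eigenvectors `(1, 0, -1) / √2` and `(1, 2, 1) / √6` of
`siteMatrix`, and the normal `(1, -1, 1) / √3` of its range. -/
def eigenBasis : Matrix (Fin 3) (Fin 3) ℂ :=
  !![invSqrtTwo, 0, -invSqrtTwo;
    invSqrtThree, -invSqrtThree, invSqrtThree;
    invSqrtTwo * invSqrtThree, 2 * invSqrtTwo * invSqrtThree, invSqrtTwo * invSqrtThree]

/-- `siteMatrix` in the basis `eigenBasis`. -/
def siteNormalForm : Matrix (Fin 3) (Fin 3) ℂ :=
  !![1, 0, 0; 0, 0, 0; 0, 2 * Complex.I * invSqrtTwo * invSqrtThree, Complex.I * invSqrtThree]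

lemma F3_conjTranspose_mul : F3ᴴ * F3 = 1 := by
  have hb := invSqrtThree_sq
  have hI := Complex.I_sq
  have hs := star_invSqrtThree
  rw [Complex.star_def] at hs
  have h2 : (starRingEnd ℂ) 2 = 2 := Complex.conj_ofNat 2
  rw [F3_eq]
  ext n m
  fin_cases n <;> fin_cases m <;>
    simp [Matrix.mul_apply, Fin.sum_univ_three, hs, h2] <;> grind

lemma eigenBasis_conjTranspose : eigenBasisᴴ = eigenBasisᵀ := by
  have hs := star_invSqrtThree
  have hs2 := star_invSqrtTwo
  rw [Complex.star_def] at hs hs2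
  rw [eigenBasis]
  ext n m
  fin_cases n <;> fin_cases m <;> simp [hs, hs2]

lemma eigenBasis_conjTranspose_mul : eigenBasisᴴ * eigenBasis = 1 := by
  have hb := invSqrtThree_sq
  have ha := invSqrtTwo_sq
  rw [eigenBasis_conjTranspose, eigenBasis]
  ext n m
  fin_cases n <;> fin_cases m <;>
    simp [Matrix.mul_apply, Fin.sum_univ_three] <;> grind

lemma eigenBasis_mul_conjTranspose : eigenBasis * eigenBasisᴴ = 1 :=
  mul_eq_one_comm.1 eigenBasis_conjTranspose_mul

/-- The one-site matrix is not normal: the middle basis vector is sent to a multiple of `f₊`. What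
counts is the zero middle row, which says that the range is orthogonal to that vector, and the two
diagonal columns. -/
lemma eigenBasis_mul_siteMatrix : eigenBasis * siteMatrix = siteNormalForm * eigenBasis := by
  have hb := invSqrtThree_sq
  have ha := invSqrtTwo_sq
  have hI := Complex.I_sq
  have hs := star_invSqrtThree
  rw [Complex.star_def] at hs
  have h2 : (starRingEnd ℂ) 2 = 2 := Complex.conj_ofNat 2
  rw [eigenBasis, siteMatrix, siteNormalForm, F3_eq]
  ext n m
  fin_cases n <;> fin_cases m <;>
    simp [Matrix.mul_apply, Fin.sum_univ_three, hs, h2] <;> grind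

/-- Eigenvalues of the one-site matrix on the vectors of `eigenBasis`; the middle one is not
an eigenvector. -/
def siteEigenvalue : Fin 3 → ℂ := ![1, 0, Complex.I * invSqrtThree]

lemma siteMatrix_mul_eigenBasis {s : Fin 3} (hs : s ≠ 1) (n : Fin 3) :
    ∑ m, siteMatrix n m * eigenBasis s m = siteEigenvalue s * eigenBasis s n := by
  have h : siteMatrix * eigenBasisᵀ = eigenBasisᵀ * siteNormalForm := by
    rw [← eigenBasis_conjTranspose]
    calc siteMatrix * eigenBasisᴴ = eigenBasisᴴ * (eigenBasis * siteMatrix) * eigenBasisᴴ := by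
          rw [← Matrix.mul_assoc, eigenBasis_conjTranspose_mul, Matrix.one_mul]
      _ = _ := by
          rw [eigenBasis_mul_siteMatrix, ← Matrix.mul_assoc, Matrix.mul_assoc _ eigenBasis,
            eigenBasis_mul_conjTranspose, Matrix.mul_one]
  have h' := congrFun (congrFun h n) s
  simp only [Matrix.mul_apply, Matrix.transpose_apply] at h'
  rw [h', Fin.sum_univ_three]
  fin_cases s
  · simp [siteNormalForm, siteEigenvalue]
  · exact absurd rfl hs
  · simp [siteNormalForm, siteEigenvalue, mul_comm]

lemma norm_eigenBasis_zero_sq (c : Fin 3) :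
    ‖eigenBasis 0 c‖ ^ 2 = ![1 / 2, 0, 1 / 2] c := by
  have h := norm_invSqrtTwo_sq
  fin_cases c <;> simp [eigenBasis] <;> linarith

lemma norm_eigenBasis_two_sq (c : Fin 3) :
    ‖eigenBasis 2 c‖ ^ 2 = ![1 / 6, 2 / 3, 1 / 6] c := by
  have h := norm_invSqrtTwo_sq
  have h' := norm_invSqrtThree_sq
  fin_cases c <;> simp [eigenBasis, mul_pow, h, h'] <;> norm_num

/-- From `F₃^† π f = λ f` it follows that `F₃ f = λ⁻¹ π f`, which has no middle entry and two outer
entries of equal modulus. This is why the momentum marginal is the Cantor measure at both edges. -/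
lemma norm_F3_mul_eigenBasis_sq {s : Fin 3} (hs : s ≠ 1) (c : Fin 3) :
    ‖(F3 * eigenBasisᴴ) c s‖ ^ 2 = ![1 / 2, 0, 1 / 2] c := by
  have hb := invSqrtThree_sq
  have ha := invSqrtTwo_sq
  have hI := Complex.I_sq
  have hn := norm_invSqrtTwo_sq
  have hentry : (F3 * eigenBasisᴴ) c s = invSqrtTwo * ![1, 0, if s = 0 then -1 else 1] c *
      (if s = 0 then 1 else -Complex.I) := by
    rw [eigenBasis_conjTranspose, eigenBasis, F3_eq]
    fin_cases s
    · fin_cases c <;> simp [Matrix.mul_apply, Fin.sum_univ_three] <;> grind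
    · exact absurd rfl hs
    · fin_cases c <;> simp [Matrix.mul_apply, Fin.sum_univ_three] <;> grind
  rw [hentry]
  fin_cases s
  · fin_cases c <;> simp [hn]
  · exact absurd rfl hs
  · fin_cases c <;> simp [hn]

/-! ### The open Walsh-baker matrix in tensor form -/

lemma openWalshBaker_apply (k : ℕ) (x y : Fin (k + 1) → Fin 3) :
    openWalshBaker (k + 1) x y = siteMatrix (x (Fin.last k)) (y 0) *
      ∏ l : Fin k, (1 : Matrix (Fin 3) (Fin 3) ℂ) (x l.castSucc) (y l.succ) := by
  -- Dependence of the summand on each digit of the intermediate index. The sum over that index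
  -- factorizes: the digit `0` meets the projection, and at the others `F₃^† F₃ = 1` while the two
  -- reversals of digits compose to a shift.
  let g : Fin (k + 1) → Fin 3 → ℂ := Fin.cons
    (fun d => if d = y 0 ∧ d ≠ 1 then F3ᴴ (x (Fin.last k)) d else 0)
    (fun l d => F3ᴴ (x l.rev.castSucc) d * F3 d (y l.rev.succ))
  have hterm : ∀ j : Fin (k + 1) → Fin 3,
      (walsh (k + 1))ᴴ x j * openBlocks k j y = ∏ l, g l (j l) := by
    intro j
    rw [Fin.prod_univ_succ]
    simp only [g, Fin.cons_zero, Fin.cons_succ, Matrix.conjTranspose_apply, walsh, openBlocks,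
      Matrix.of_apply, star_prod, Fin.tail]
    split_ifs
    · rw [Fin.prod_univ_succ, Fin.rev_zero, Finset.prod_mul_distrib, mul_assoc]
      simp only [Fin.rev_succ]
    · simp
  rw [openWalshBaker, Matrix.mul_apply, Finset.sum_congr rfl fun j _ => hterm j,
    sum_prod_eq_prod_sum, Fin.prod_univ_succ]
  congr 1
  · simp only [g, Fin.cons_zero, siteMatrix, Matrix.of_apply]
    rw [Finset.sum_eq_single (y 0)]
    · by_cases h : y 0 = 1 <;> simp [h]
    · intro d _ hd
      simp [hd]
    · simp
  · rw [← Equiv.prod_comp Fin.revPerm]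
    refine Finset.prod_congr rfl fun l _ => ?_
    simp only [g, Fin.cons_succ, Fin.revPerm_apply, Fin.rev_rev]
    rw [← Matrix.mul_apply, F3_conjTranspose_mul]

lemma finRotate_castSucc {k : ℕ} (l : Fin k) : finRotate (k + 1) l.castSucc = l.succ := by
  rw [finRotate_apply, Fin.coeSucc_eq_succ]

/-- The digits `x`, cyclically shifted by one place to the right. -/
def shiftDigits {k : ℕ} (x : Fin (k + 1) → Fin 3) : Fin (k + 1) → Fin 3 :=
  x ∘ (finRotate (k + 1)).symm

lemma shiftDigits_zero {k : ℕ} (x : Fin (k + 1) → Fin 3) : shiftDigits x 0 = x (Fin.last k) := by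
  rw [shiftDigits, Function.comp_apply, ← finRotate_last, Equiv.symm_apply_apply]

lemma shiftDigits_succ {k : ℕ} (x : Fin (k + 1) → Fin 3) (l : Fin k) :
    shiftDigits x l.succ = x l.castSucc := by
  rw [shiftDigits, Function.comp_apply, ← finRotate_castSucc, Equiv.symm_apply_apply]

/-- The open Walsh-baker map acts as a shift followed by the one-site matrix on the last site. -/
lemma openWalshBaker_mulVec (k : ℕ) (ψ : (Fin (k + 1) → Fin 3) → ℂ) :
    openWalshBaker (k + 1) *ᵥ ψ = tensorApply (Function.update (fun _ => 1) (Fin.last k) siteMatrix)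
      (fun x => ψ (shiftDigits x)) := by
  ext x
  rw [Matrix.mulVec_eq_sum]
  simp only [Finset.sum_apply, Pi.smul_apply, tensorApply]
  refine (Fintype.sum_equiv (Equiv.arrowCongr (finRotate (k + 1)) (Equiv.refl (Fin 3)))
    _ _ fun y => ?_).symm
  have hy : (Equiv.arrowCongr (finRotate (k + 1)) (Equiv.refl (Fin 3))) y = shiftDigits y := rfl
  rw [hy, Fin.prod_univ_castSucc]
  simp only [Matrix.transpose_apply, openWalshBaker_apply, shiftDigits_zero,
    Function.update_self, MulOpposite.smul_eq_mul_unop, MulOpposite.unop_op]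
  congr 1
  rw [mul_comm]
  congr 1
  refine Finset.prod_congr rfl fun l _ => ?_
  rw [Function.update_of_ne (Fin.castSucc_lt_last l).ne, shiftDigits_succ]

/-! ### Eigenstates in the basis of one-site eigenvectors -/

section Eigen

variable {k : ℕ} {ψ : (Fin (k + 1) → Fin 3) → ℂ} {z : ℂ}

/-- The coordinates of `ψ` in the tensor basis built from `eigenBasis`. -/
def eigenCoord {ι : Type*} [Fintype ι] [DecidableEq ι] (ψ : (ι → Fin 3) → ℂ) :
    (ι → Fin 3) → ℂ :=
  tensorApply (fun _ => eigenBasis) ψ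

lemma sum_norm_sq_eigenCoord {ι : Type*} [Fintype ι] [DecidableEq ι] (ψ : (ι → Fin 3) → ℂ) :
    ∑ η, ‖eigenCoord ψ η‖ ^ 2 = ∑ x, ‖ψ x‖ ^ 2 :=
  sum_norm_sq_tensorApply (fun _ => eigenBasis_conjTranspose_mul) ψ

/-- The uniform change of basis passes through the shift and alters only the one-site matrix at the
last place. -/
lemma eigenCoord_equation (h : openWalshBaker (k + 1) *ᵥ ψ = z • ψ) (η : Fin (k + 1) → Fin 3) :
    z * eigenCoord ψ η = ∑ m, siteNormalForm (η (Fin.last k)) m *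
      eigenCoord ψ (shiftDigits (Function.update η (Fin.last k) m)) := by
  have hcomm : (fun i : Fin (k + 1) => eigenBasis *
      (Function.update (fun _ => 1) (Fin.last k) siteMatrix :
        Fin (k + 1) → Matrix (Fin 3) (Fin 3) ℂ) i) =
      fun i => (Function.update (fun _ => 1) (Fin.last k) siteNormalForm :
        Fin (k + 1) → Matrix (Fin 3) (Fin 3) ℂ) i * eigenBasis := by
    ext1 i
    by_cases hi : i = Fin.last k
    · subst hi
      simp [eigenBasis_mul_siteMatrix]
    · simp [Function.update_of_ne hi]
  have hshift : tensorApply (fun _ => eigenBasis) (fun x => ψ (shiftDigits x)) =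
      fun c => eigenCoord ψ (shiftDigits c) :=
    tensorApply_comp_equiv eigenBasis (finRotate (k + 1)).symm ψ
  have key : z • eigenCoord ψ = tensorApply (Function.update (fun _ => 1) (Fin.last k)
      siteNormalForm) (fun c => eigenCoord ψ (shiftDigits c)) := by
    rw [eigenCoord, ← tensorApply_smul, ← h, openWalshBaker_mulVec, tensorApply_comp, hcomm,
      ← tensorApply_comp, hshift]
    rfl
  have := congrFun key η
  rwa [tensorApply_update_one] at this

/-- The zero row of `siteNormalForm` excludes the digit `1` at the last site. The eigenvalue
equation relates site `j` to site `j + 1`, so the exclusion travels backwards to all sites. -/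
lemma eigenCoord_eq_zero (h : openWalshBaker (k + 1) *ᵥ ψ = z • ψ) (hz : z ≠ 0)
    (i : Fin (k + 1)) (η : Fin (k + 1) → Fin 3) (hη : η i = 1) : eigenCoord ψ η = 0 := by
  induction i using Fin.reverseInduction generalizing η with
  | last =>
    have := eigenCoord_equation h η
    rw [hη] at this
    refine (mul_eq_zero.1 (this.trans ?_)).resolve_left hz
    refine Finset.sum_eq_zero fun m _ => ?_
    fin_cases m <;> simp [siteNormalForm]
  | cast j ih =>
    have := eigenCoord_equation h η
    refine (mul_eq_zero.1 (this.trans ?_)).resolve_left hz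
    refine Finset.sum_eq_zero fun m _ => ?_
    rw [ih, mul_zero]
    rw [shiftDigits_succ, Function.update_of_ne (Fin.castSucc_lt_last j).ne, hη]

/-- The only off-diagonal entry of the normal form multiplies a coordinate with digit `1` at the
first site, which vanishes. -/
lemma mul_eigenCoord (h : openWalshBaker (k + 1) *ᵥ ψ = z • ψ) (hz : z ≠ 0)
    (η : Fin (k + 1) → Fin 3) :
    z * eigenCoord ψ η = siteEigenvalue (η (Fin.last k)) * eigenCoord ψ (shiftDigits η) := by
  rw [eigenCoord_equation h η, Fin.sum_univ_three]
  have h1 : eigenCoord ψ (shiftDigits (Function.update η (Fin.last k) 1)) = 0 :=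
    eigenCoord_eq_zero h hz 0 _ (by rw [shiftDigits_zero, Function.update_self])
  rw [h1]
  have hself := Function.update_eq_self (Fin.last k) η
  generalize η (Fin.last k) = d at hself
  fin_cases d
  · simp only [Fin.zero_eta] at hself
    simp [siteNormalForm, siteEigenvalue, hself]
  · simp [siteNormalForm, siteEigenvalue]
  · simp only [Fin.reduceFinMk] at hself
    simp [siteNormalForm, siteEigenvalue, hself]

/-- Squared moduli of the one-site eigenvalues. -/
def siteDecay : Fin 3 → ℝ := ![1, 0, 1 / 3]

lemma norm_siteEigenvalue_sq (s : Fin 3) : ‖siteEigenvalue s‖ ^ 2 = siteDecay s := by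
  have := norm_invSqrtThree_sq
  fin_cases s <;> simp_all [siteEigenvalue, siteDecay]

/-- Transport of mass along the shift. With `P` always true it expresses `|z|²` by the first site;
with `P` a defect at one site it compares defects at neighbouring sites. -/
lemma norm_sq_mul_sum_eigenCoord (h : openWalshBaker (k + 1) *ᵥ ψ = z • ψ) (hz : z ≠ 0)
    (P : (Fin (k + 1) → Fin 3) → Prop) [DecidablePred P] :
    ‖z‖ ^ 2 * ∑ η with P η, ‖eigenCoord ψ η‖ ^ 2 =
      ∑ ξ with P (ξ ∘ finRotate (k + 1)), siteDecay (ξ 0) * ‖eigenCoord ψ ξ‖ ^ 2 := by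
  rw [Finset.mul_sum]
  refine Finset.sum_nbij' shiftDigits (fun ξ => ξ ∘ finRotate (k + 1)) ?_ ?_ ?_ ?_ ?_
  · intro η hη
    have : shiftDigits η ∘ finRotate (k + 1) = η := by ext i; simp [shiftDigits]
    simpa [this] using hη
  · intro ξ hξ
    simpa using hξ
  · intro η _
    ext i; simp [shiftDigits]
  · intro ξ _
    ext i; simp [shiftDigits]
  · intro η _
    rw [← mul_pow, ← norm_mul, mul_eigenCoord h hz, norm_mul, mul_pow, norm_siteEigenvalue_sq,
      shiftDigits_zero]

lemma siteDecay_mul_le (ξ : Fin (k + 1) → Fin 3) :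
    siteDecay (ξ 0) * ‖eigenCoord ψ ξ‖ ^ 2 ≤ ‖eigenCoord ψ ξ‖ ^ 2 := by
  refine mul_le_of_le_one_left (sq_nonneg _) ?_
  generalize ξ 0 = d
  fin_cases d <;> (simp [siteDecay]; try norm_num)

/-- Where the coordinate is nonzero the first digit is `0` or `2`, so the weight is affine in either
defect indicator. The first form serves the outer edge, the second the inner edge. -/
lemma siteDecay_eq (h : openWalshBaker (k + 1) *ᵥ ψ = z • ψ) (hz : z ≠ 0)
    (ξ : Fin (k + 1) → Fin 3) :
    siteDecay (ξ 0) * ‖eigenCoord ψ ξ‖ ^ 2 = ‖eigenCoord ψ ξ‖ ^ 2 -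
      2 / 3 * (if ξ 0 ≠ 0 then ‖eigenCoord ψ ξ‖ ^ 2 else 0) ∧
    siteDecay (ξ 0) * ‖eigenCoord ψ ξ‖ ^ 2 = 1 / 3 * ‖eigenCoord ψ ξ‖ ^ 2 +
      2 / 3 * (if ξ 0 ≠ 2 then ‖eigenCoord ψ ξ‖ ^ 2 else 0) := by
  by_cases h1 : ξ 0 = 1
  · rw [eigenCoord_eq_zero h hz 0 ξ h1]
    simp
  · generalize ‖eigenCoord ψ ξ‖ ^ 2 = t
    generalize ξ 0 = d at h1
    fin_cases d
    · constructor <;> simp [siteDecay]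
      ring
    · exact absurd rfl h1
    · constructor <;> simp [siteDecay]
      ring

lemma norm_sq_mul_defectMass_le (h : openWalshBaker (k + 1) *ᵥ ψ = z • ψ) (hz : z ≠ 0)
    (i : Fin (k + 1)) (s : Fin 3) :
    ‖z‖ ^ 2 * defectMass (eigenCoord ψ) i s ≤
      defectMass (eigenCoord ψ) (finRotate (k + 1) i) s := by
  rw [defectMass, norm_sq_mul_sum_eigenCoord h hz]
  exact Finset.sum_le_sum fun ξ _ => siteDecay_mul_le ξ

lemma defectMass_finRotate_le (h : openWalshBaker (k + 1) *ᵥ ψ = z • ψ) (hz : z ≠ 0)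
    (i : Fin (k + 1)) (s : Fin 3) :
    defectMass (eigenCoord ψ) (finRotate (k + 1) i) s ≤
      3 * (‖z‖ ^ 2 * defectMass (eigenCoord ψ) i s) := by
  rw [defectMass, defectMass, norm_sq_mul_sum_eigenCoord h hz, Finset.mul_sum]
  refine Finset.sum_le_sum fun ξ _ => ?_
  have h2 := (siteDecay_eq h hz ξ).2
  have h0 : 0 ≤ (if ξ 0 ≠ 2 then ‖eigenCoord ψ ξ‖ ^ 2 else 0) := by
    split_ifs
    exacts [sq_nonneg _, le_rfl]
  linarith

lemma norm_sq_eq_sum (h : openWalshBaker (k + 1) *ᵥ ψ = z • ψ) (hz : z ≠ 0)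
    (hψ : ∑ x, ‖ψ x‖ ^ 2 = 1) :
    ‖z‖ ^ 2 = ∑ ξ : Fin (k + 1) → Fin 3, siteDecay (ξ 0) * ‖eigenCoord ψ ξ‖ ^ 2 := by
  have := norm_sq_mul_sum_eigenCoord h hz (fun _ => True)
  simpa [sum_norm_sq_eigenCoord, hψ] using this

/-- The mass of the defect at the first site is fixed by the eigenvalue. -/
lemma defectMass_zero_zero (h : openWalshBaker (k + 1) *ᵥ ψ = z • ψ) (hz : z ≠ 0)
    (hψ : ∑ x, ‖ψ x‖ ^ 2 = 1) :
    defectMass (eigenCoord ψ) 0 0 = 3 / 2 * (1 - ‖z‖ ^ 2) := by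
  have := norm_sq_eq_sum h hz hψ
  rw [Finset.sum_congr rfl fun ξ _ => (siteDecay_eq h hz ξ).1, Finset.sum_sub_distrib,
    sum_norm_sq_eigenCoord, hψ, ← Finset.mul_sum, ← Finset.sum_filter] at this
  rw [defectMass]
  linarith

lemma defectMass_zero_two (h : openWalshBaker (k + 1) *ᵥ ψ = z • ψ) (hz : z ≠ 0)
    (hψ : ∑ x, ‖ψ x‖ ^ 2 = 1) :
    defectMass (eigenCoord ψ) 0 2 = 3 / 2 * (‖z‖ ^ 2 - 1 / 3) := by
  have := norm_sq_eq_sum h hz hψ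
  rw [Finset.sum_congr rfl fun ξ _ => (siteDecay_eq h hz ξ).2, Finset.sum_add_distrib,
    ← Finset.mul_sum, sum_norm_sq_eigenCoord, hψ, ← Finset.mul_sum, ← Finset.sum_filter] at this
  rw [defectMass]
  linarith

/-- Weights on the support are at least `1/3`, and `|z| ≤ 1` because the first-site defect from `0`
is nonnegative. -/
lemma defectMass_finRotate_le_three_mul (h : openWalshBaker (k + 1) *ᵥ ψ = z • ψ) (hz : z ≠ 0)
    (hψ : ∑ x, ‖ψ x‖ ^ 2 = 1) (i : Fin (k + 1)) (s : Fin 3) :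
    defectMass (eigenCoord ψ) (finRotate (k + 1) i) s ≤ 3 * defectMass (eigenCoord ψ) i s := by
  have h1 := defectMass_finRotate_le h hz i s
  have hz1 : ‖z‖ ^ 2 ≤ 1 := by
    have := defectMass_zero_zero h hz hψ
    linarith [defectMass_nonneg (eigenCoord ψ) 0 0]
  have := mul_le_mul_of_nonneg_right hz1 (defectMass_nonneg (eigenCoord ψ) i s)
  linarith

/-- Weights are at most `1`, and `|z|² ≥ 1/3` because the first-site defect from `2` is nonnegative.
-/
lemma defectMass_le_three_mul_finRotate (h : openWalshBaker (k + 1) *ᵥ ψ = z • ψ) (hz : z ≠ 0)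
    (hψ : ∑ x, ‖ψ x‖ ^ 2 = 1) (i : Fin (k + 1)) (s : Fin 3) :
    defectMass (eigenCoord ψ) i s ≤ 3 * defectMass (eigenCoord ψ) (finRotate (k + 1) i) s := by
  have h1 := norm_sq_mul_defectMass_le h hz i s
  have hz1 : 1 / 3 ≤ ‖z‖ ^ 2 := by
    have := defectMass_zero_two h hz hψ
    linarith [defectMass_nonneg (eigenCoord ψ) 0 2]
  have := mul_le_mul_of_nonneg_right hz1 (defectMass_nonneg (eigenCoord ψ) i s)
  linarith

lemma defectMass_le_pow_left (h : openWalshBaker (k + 1) *ᵥ ψ = z • ψ) (hz : z ≠ 0)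
    (hψ : ∑ x, ‖ψ x‖ ^ 2 = 1) (i : Fin (k + 1)) (s : Fin 3) :
    defectMass (eigenCoord ψ) i s ≤ 3 ^ (i : ℕ) * defectMass (eigenCoord ψ) 0 s := by
  induction i using Fin.induction with
  | zero => simp
  | succ j ih =>
    have := defectMass_finRotate_le_three_mul h hz hψ j.castSucc s
    rw [finRotate_castSucc] at this
    rw [Fin.val_succ, pow_succ]
    simp only [Fin.val_castSucc] at ih
    linarith

/-- The last sites are reached from the first one across the cyclic boundary, and that crossing
costs the extra factor `3`. -/
lemma defectMass_le_pow_right (h : openWalshBaker (k + 1) *ᵥ ψ = z • ψ) (hz : z ≠ 0)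
    (hψ : ∑ x, ‖ψ x‖ ^ 2 = 1) (i : Fin (k + 1)) (s : Fin 3) :
    defectMass (eigenCoord ψ) i s ≤
      3 ^ ((i.rev : ℕ) + 1) * defectMass (eigenCoord ψ) 0 s := by
  induction i using Fin.reverseInduction with
  | last =>
    have := defectMass_le_three_mul_finRotate h hz hψ (Fin.last k) s
    rw [finRotate_last] at this
    simpa using this
  | cast j ih =>
    have := defectMass_le_three_mul_finRotate h hz hψ j.castSucc s
    rw [finRotate_castSucc] at this
    have hrev : (j.castSucc.rev : ℕ) = (j.succ.rev : ℕ) + 1 := by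
      simp only [Fin.val_rev, Fin.val_succ, Fin.val_castSucc]
      omega
    rw [hrev, pow_succ]
    linarith

end Eigen

/-- Product states built from a one-site eigenvector are eigenstates. -/
lemma openWalshBaker_mulVec_prod {s : Fin 3} (hs : s ≠ 1) (k : ℕ) :
    openWalshBaker (k + 1) *ᵥ (fun x => ∏ i, eigenBasis s (x i)) =
      siteEigenvalue s • fun x => ∏ i, eigenBasis s (x i) := by
  have hshift : ∀ x : Fin (k + 1) → Fin 3,
      ∏ i, eigenBasis s (shiftDigits x i) = ∏ i, eigenBasis s (x i) := fun x =>
    Equiv.prod_comp (finRotate (k + 1)).symm fun i => eigenBasis s (x i)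
  rw [openWalshBaker_mulVec]
  simp only [hshift]
  ext x
  rw [tensorApply_update_one, Pi.smul_apply, smul_eq_mul]
  simp only [Fin.prod_univ_castSucc, Function.update_self,
    Function.update_of_ne (Fin.castSucc_lt_last _).ne]
  rw [mul_left_comm, ← siteMatrix_mul_eigenBasis hs, Finset.mul_sum]
  exact Finset.sum_congr rfl fun m _ => by ring

lemma sum_norm_sq_prod_eigenBasis (s : Fin 3) (k : ℕ) :
    ∑ x : Fin k → Fin 3, ‖∏ i, eigenBasis s (x i)‖ ^ 2 = 1 := by
  have h1 : ∑ j, ‖eigenBasis s j‖ ^ 2 = 1 := by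
    have h := congrFun (congrFun eigenBasis_mul_conjTranspose s) s
    simp only [Matrix.mul_apply, Matrix.conjTranspose_apply, Matrix.one_apply_eq,
      Complex.star_def, Complex.mul_conj'] at h
    exact_mod_cast h
  simp only [norm_prod, ← Finset.prod_pow]
  rw [sum_prod_eq_prod_sum (fun _ j => ‖eigenBasis s j‖ ^ 2)]
  simp [h1]

/-! ### Walsh-Husimi weights as cylinder masses -/

/-- The site matrices that compute the overlaps with Walsh coherent states. -/
def coherentMatrix (k b : ℕ) (i : Fin k) : Matrix (Fin 3) (Fin 3) ℂ :=
  if (i : ℕ) < b then 1 else F3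

/-- Position digits followed by reversed momentum digits. -/
def joinDigits (k b : ℕ) (ε' : Fin (k - b) → Fin 3) (ε : Fin b → Fin 3) (i : Fin k) : Fin 3 :=
  if h : (i : ℕ) < b then ε ⟨i, h⟩ else ε' ⟨k - 1 - i, by omega⟩

lemma husimiWeight_eq (k b : ℕ) (ψ : QState k) (ε' : Fin (k - b) → Fin 3) (ε : Fin b → Fin 3) :
    husimiWeight k b ψ ε' ε =
      ‖tensorApply (coherentMatrix k b) ψ.ofLp (joinDigits k b ε' ε)‖ ^ 2 := by
  rw [husimiWeight, ← norm_star, PiLp.inner_apply, tensorApply, star_sum]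
  congr 2
  refine Finset.sum_congr rfl fun x _ => ?_
  rw [RCLike.inner_apply, star_mul']
  simp only [coherentState, star_prod, Complex.star_def, Complex.conj_conj]
  congr 1
  refine Finset.prod_congr rfl fun i _ => ?_
  by_cases h : (i : ℕ) < b
  · simp only [coherentMatrix, joinDigits, h, dite_true, if_true, Matrix.one_apply]
    simp only [eq_comm (a := x i)]
    split_ifs <;> simp
  · simp only [coherentMatrix, joinDigits, h, dite_false, if_false, Matrix.conjTranspose_apply]
    rw [Complex.star_def, Complex.conj_conj]

/-- Splitting of digit strings into position and momentum digits. -/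
def joinDigitsEquiv {k b : ℕ} (hb : b ≤ k) :
    (Fin (k - b) → Fin 3) × (Fin b → Fin 3) ≃ (Fin k → Fin 3) where
  toFun e := joinDigits k b e.1 e.2
  invFun c := (fun j => c ⟨k - 1 - j, by omega⟩, fun i => c (Fin.castLE hb i))
  left_inv e := by
    obtain ⟨ε', ε⟩ := e
    ext j
    · have h : ¬ (k - 1 - (j : ℕ)) < b := by omega
      have h' : k - 1 - (k - 1 - (j : ℕ)) = j := by omega
      simp [joinDigits, h, h']
    · simp [joinDigits]
  right_inv c := by
    ext i
    by_cases h : (i : ℕ) < b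
    · simp [joinDigits, h]
    · have hrev : k - 1 - (k - 1 - (i : ℕ)) = i := by omega
      simp [joinDigits, h, hrev]

/-- The first `v` and the last `v` sites. -/
def edgeSites {k v : ℕ} (hv : v ≤ k) : Finset (Fin k) :=
  Finset.univ.image (Fin.castLE hv) ∪ Finset.univ.image fun j => (Fin.castLE hv j).rev

/-- A digit string with prescribed digits on `edgeSites`. -/
def edgeDigits (k : ℕ) {v : ℕ} (δ' δ : Fin v → Fin 3) (i : Fin k) : Fin 3 :=
  if h : (i : ℕ) < v then δ ⟨i, h⟩ else if h' : (i.rev : ℕ) < v then δ' ⟨i.rev, h'⟩ else 0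

section EdgeSites

variable {k v : ℕ} (hvk : v ≤ k)

lemma edgeDigits_rev (hv : 2 * v ≤ k) (δ' δ : Fin v → Fin 3) (j : Fin v) :
    edgeDigits k δ' δ (Fin.castLE hvk j).rev = δ' j := by
  have h : ¬ (((Fin.castLE hvk j).rev : Fin k) : ℕ) < v := by
    rw [Fin.val_rev, Fin.val_castLE]; omega
  rw [edgeDigits, dif_neg h]
  simp only [Fin.rev_rev]
  rw [dif_pos (by simp)]
  rfl

lemma edgeDigits_castLE (δ' δ : Fin v → Fin 3) (j : Fin v) :
    edgeDigits k δ' δ (Fin.castLE hvk j) = δ j := by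
  rw [edgeDigits, dif_pos (by simp)]
  rfl

lemma card_edgeSites_le : (edgeSites hvk).card ≤ 2 * v := by
  refine (Finset.card_union_le _ _).trans ?_
  have h1 := Finset.card_image_le (s := Finset.univ) (f := Fin.castLE hvk)
  have h2 := Finset.card_image_le (s := Finset.univ) (f := fun j : Fin v => (Fin.castLE hvk j).rev)
  simp only [Finset.card_univ, Fintype.card_fin] at h1 h2
  omega

lemma forall_mem_edgeSites {P : Fin k → Prop} :
    (∀ i ∈ edgeSites hvk, P i) ↔
      (∀ j : Fin v, P (Fin.castLE hvk j).rev) ∧ ∀ j : Fin v, P (Fin.castLE hvk j) := by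
  simp only [edgeSites, Finset.mem_union, Finset.mem_image, Finset.mem_univ, true_and]
  constructor
  · intro h
    exact ⟨fun j => h _ (Or.inr ⟨j, rfl⟩), fun j => h _ (Or.inl ⟨j, rfl⟩)⟩
  · rintro ⟨h, h'⟩ i (⟨j, rfl⟩ | ⟨j, rfl⟩)
    exacts [h' j, h j]

lemma prod_edgeSites (hv : 2 * v ≤ k) (f : Fin k → ℝ) :
    ∏ i ∈ edgeSites hvk, f i =
      (∏ j : Fin v, f (Fin.castLE hvk j)) * ∏ j : Fin v, f (Fin.castLE hvk j).rev := by
  rw [edgeSites, Finset.prod_union, Finset.prod_image, Finset.prod_image]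
  · intro a _ b _ h
    exact Fin.castLE_injective hvk (Fin.rev_injective h)
  · exact fun a _ b _ h => Fin.castLE_injective hvk h
  · rw [Finset.disjoint_left]
    intro i hi hi'
    obtain ⟨a, -, rfl⟩ := Finset.mem_image.1 hi
    obtain ⟨b, -, hb⟩ := Finset.mem_image.1 hi'
    have := congrArg Fin.val hb
    rw [Fin.val_rev, Fin.val_castLE, Fin.val_castLE] at this
    omega

/-- Momentum digits enter coherent states in reverse order, so the leading ones sit on the last
sites; the remaining digits are summed out. -/
lemma husimi_rectangle_eq_cylinderMass (hv : 2 * v ≤ k) {b : ℕ} (hbk : b ≤ k) (hvb : v ≤ b)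
    (hvb' : v ≤ k - b)
    (ψ : QState k) (δ' δ : Fin v → Fin 3) :
    husimi k b ψ (rectangle δ' δ) = ENNReal.ofReal (cylinderMass (edgeSites hvk)
      (edgeDigits k δ' δ) (tensorApply (coherentMatrix k b) ψ.ofLp)) := by
  classical
  rw [husimi_rectangle hvb hvb']
  congr 1
  rw [cylinderMass, Finset.sum_filter, ← (joinDigitsEquiv hbk).sum_comp, Fintype.sum_prod_type]
  refine Finset.sum_congr rfl fun ε' _ => Finset.sum_congr rfl fun ε _ => ?_
  rw [husimiWeight_eq]
  have hiff : ((∀ i, ε' (Fin.castLE hvb' i) = δ' i) ∧ ∀ i, ε (Fin.castLE hvb i) = δ i) ↔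
      ∀ i ∈ edgeSites hvk, joinDigitsEquiv hbk (ε', ε) i = edgeDigits k δ' δ i := by
    rw [forall_mem_edgeSites]
    simp only [edgeDigits_rev hvk hv, edgeDigits_castLE]
    refine and_congr (forall_congr' fun j => ?_) (forall_congr' fun j => ?_)
    · have h : ¬ (((Fin.castLE hvk j).rev : Fin k) : ℕ) < b := by
        rw [Fin.val_rev, Fin.val_castLE]; omega
      have h' : k - 1 - (((Fin.castLE hvk j).rev : Fin k) : ℕ) = j := by
        rw [Fin.val_rev, Fin.val_castLE]; omega
      have : joinDigitsEquiv hbk (ε', ε) (Fin.castLE hvk j).rev = ε' (Fin.castLE hvb' j) := by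
        change joinDigits k b ε' ε _ = _
        rw [joinDigits, dif_neg h]
        congr 1
        ext
        exact h'
      rw [this]
    · have : joinDigitsEquiv hbk (ε', ε) (Fin.castLE hvk j) = ε (Fin.castLE hvb j) := by
        change joinDigits k b ε' ε _ = _
        rw [joinDigits, dif_pos (by simp; omega)]
        rfl
      rw [this]
  by_cases hc : (∀ i, ε' (Fin.castLE hvb' i) = δ' i) ∧ ∀ i, ε (Fin.castLE hvb i) = δ i
  · rw [if_pos hc, if_pos (hiff.1 hc)]
    rfl
  · rw [if_neg hc, if_neg (fun h => hc (hiff.2 h))]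

end EdgeSites

/-! ### Convergence at the spectral edges -/

/-- The overlap matrices of coherent states with the basis of one-site eigenvectors. -/
def overlapMatrix (k b : ℕ) (i : Fin k) : Matrix (Fin 3) (Fin 3) ℂ :=
  coherentMatrix k b i * eigenBasisᴴ

lemma overlapMatrix_unitary (k b : ℕ) (i : Fin k) :
    (overlapMatrix k b i)ᴴ * overlapMatrix k b i = 1 := by
  have hC : (coherentMatrix k b i)ᴴ * coherentMatrix k b i = 1 := by
    rw [coherentMatrix]
    split_ifs
    · simp
    · exact F3_conjTranspose_mul
  rw [overlapMatrix, Matrix.conjTranspose_mul, Matrix.conjTranspose_conjTranspose,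
    Matrix.mul_assoc, ← Matrix.mul_assoc _ _ eigenBasisᴴ, hC, Matrix.one_mul,
    eigenBasis_mul_conjTranspose]

lemma tensorApply_overlapMatrix (k b : ℕ) (ψ : (Fin k → Fin 3) → ℂ) :
    tensorApply (overlapMatrix k b) (eigenCoord ψ) = tensorApply (coherentMatrix k b) ψ := by
  rw [eigenCoord, tensorApply_comp]
  simp only [overlapMatrix, Matrix.mul_assoc, eigenBasis_conjTranspose_mul, Matrix.mul_one]

/-- The limiting weight of the square `[δ'·δ]` for the one-site eigenvector number `s`. -/
def edgeWeight (s : Fin 3) {v : ℕ} (δ' δ : Fin v → Fin 3) : ℝ :=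
  (∏ j, ‖eigenBasis s (δ j)‖ ^ 2) * ∏ j, (![1 / 2, 0, 1 / 2] (δ' j) : ℝ)

lemma prod_edgeSites_overlapMatrix {k v b : ℕ} (hvk : v ≤ k) (hv : 2 * v ≤ k) (hvb : v ≤ b)
    (hvb' : v ≤ k - b) {s : Fin 3} (hs : s ≠ 1) (δ' δ : Fin v → Fin 3) :
    ∏ i ∈ edgeSites hvk, ‖overlapMatrix k b i (edgeDigits k δ' δ i) s‖ ^ 2 =
      edgeWeight s δ' δ := by
  rw [prod_edgeSites hvk hv, edgeWeight]
  congr 1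
  · refine Finset.prod_congr rfl fun j _ => ?_
    rw [edgeDigits_castLE, overlapMatrix, coherentMatrix, if_pos (by simp; omega), Matrix.one_mul,
      Matrix.conjTranspose_apply, norm_star]
  · refine Finset.prod_congr rfl fun j _ => ?_
    rw [edgeDigits_rev hvk hv, overlapMatrix, coherentMatrix,
      if_neg (by rw [Fin.val_rev, Fin.val_castLE]; omega), norm_F3_mul_eigenBasis_sq hs]

/-- The mass of defects at the first site of an eigenstate with eigenvalue `z`, relative to the
one-site eigenvector number `s`. -/
def edgeDefect (s : Fin 3) (z : ℂ) : ℝ :=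
  if s = 0 then 3 / 2 * (1 - ‖z‖ ^ 2) else 3 / 2 * (‖z‖ ^ 2 - 1 / 3)

lemma sum_edgeSites_defectMass_le {k v : ℕ} (hvk : v ≤ k) (hk : 0 < k)
    {ψ : (Fin k → Fin 3) → ℂ} {z : ℂ} (h : openWalshBaker k *ᵥ ψ = z • ψ) (hz : z ≠ 0)
    (hψ : ∑ x, ‖ψ x‖ ^ 2 = 1) {s : Fin 3} (hs : s ≠ 1) :
    ∑ i ∈ edgeSites hvk, defectMass (eigenCoord ψ) i s ≤ 2 * v * (3 ^ v * edgeDefect s z) := by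
  obtain ⟨k, rfl⟩ : ∃ m, k = m + 1 := ⟨k - 1, by omega⟩
  have hzero : defectMass (eigenCoord ψ) 0 s = edgeDefect s z := by
    fin_cases s
    · exact defectMass_zero_zero h hz hψ
    · exact absurd rfl hs
    · exact defectMass_zero_two h hz hψ
  have h0 : 0 ≤ edgeDefect s z := hzero ▸ defectMass_nonneg _ _ _
  have hsite : ∀ i ∈ edgeSites hvk,
      defectMass (eigenCoord ψ) i s ≤ 3 ^ v * edgeDefect s z := by
    rw [forall_mem_edgeSites, ← hzero]
    rw [← hzero] at h0
    constructor
    · intro j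
      refine (defectMass_le_pow_right h hz hψ _ s).trans ?_
      rw [Fin.rev_rev, Fin.val_castLE]
      exact mul_le_mul_of_nonneg_right (pow_le_pow_right₀ (by norm_num) j.isLt) h0
    · intro j
      refine (defectMass_le_pow_left h hz hψ _ s).trans ?_
      rw [Fin.val_castLE]
      exact mul_le_mul_of_nonneg_right (pow_le_pow_right₀ (by norm_num) j.isLt.le) h0
  refine (Finset.sum_le_card_nsmul _ _ _ hsite).trans ?_
  rw [nsmul_eq_mul]
  refine mul_le_mul_of_nonneg_right ?_ (by positivity)
  exact_mod_cast card_edgeSites_le hvk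

lemma mulVec_of_toEuclideanLin {k : ℕ} {ψ : QState k} {z : ℂ}
    (h : Matrix.toEuclideanLin (openWalshBaker k) ψ = z • ψ) :
    openWalshBaker k *ᵥ ψ.ofLp = z • ψ.ofLp := by
  have := congrArg WithLp.ofLp h
  simpa using this

lemma sum_norm_sq_of_norm_eq_one {k : ℕ} {ψ : QState k} (h : ‖ψ‖ = 1) :
    ∑ x, ‖ψ.ofLp x‖ ^ 2 = 1 := by
  rw [← EuclideanSpace.norm_sq_eq, h, one_pow]

/-- Common to both edges. For fixed `v` the total defect on the edge sites is at most a constant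
times the first-site defect, uniformly in `k`, and the product approximation does the rest. -/
theorem tendsto_husimi_rectangle {k : ℕ → ℕ} {Ψ : (n : ℕ) → QState (k n)} {z : ℕ → ℂ}
    (h : IsEigenstateSequence k Ψ z) (hz : ∀ᶠ n in atTop, z n ≠ 0) {s : Fin 3} (hs : s ≠ 1)
    (hd : Tendsto (fun n => edgeDefect s (z n)) atTop (𝓝 0)) {v : ℕ} (δ' δ : Fin v → Fin 3) :
    Tendsto (fun n => husimi (k n) (k n / 2) (Ψ n) (rectangle δ' δ)) atTop
      (𝓝 (ENNReal.ofReal (edgeWeight s δ' δ))) := by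
  have hlarge : ∀ᶠ n in atTop, 2 * v + 1 ≤ k n := h.tendsto_k.eventually_ge_atTop _
  let D : ℕ → ℝ := fun n => 2 * v * (3 ^ v * edgeDefect s (z n))
  have hD : Tendsto D atTop (𝓝 0) := by
    simpa using (hd.const_mul ((3 : ℝ) ^ v)).const_mul (2 * (v : ℝ))
  have hbound : Tendsto (fun n => 3 * Real.sqrt (D n) + edgeWeight s δ' δ * D n) atTop (𝓝 0) := by
    have hsqrt := (Real.continuous_sqrt.tendsto 0).comp hD
    simpa using (hsqrt.const_mul 3).add (hD.const_mul (edgeWeight s δ' δ))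
  have hreal : ∀ᶠ n in atTop,
      husimi (k n) (k n / 2) (Ψ n) (rectangle δ' δ) ≠ ∞ ∧
      |(husimi (k n) (k n / 2) (Ψ n) (rectangle δ' δ)).toReal - edgeWeight s δ' δ| ≤
        3 * Real.sqrt (D n) + edgeWeight s δ' δ * D n := by
    filter_upwards [hz, hlarge] with n hzn hkn
    have hv : 2 * v ≤ k n := by omega
    have hvk : v ≤ k n := by omega
    have hvb : v ≤ k n / 2 := by omega
    have hvb' : v ≤ k n - k n / 2 := by omega
    have hψ := sum_norm_sq_of_norm_eq_one (h.norm_eq_one n)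
    have hsum := sum_edgeSites_defectMass_le hvk (by omega) (mulVec_of_toEuclideanLin (h.eigen n))
      hzn hψ hs
    have := abs_cylinderMass_tensorApply_sub_le (overlapMatrix_unitary (k n) (k n / 2))
      (edgeSites hvk) (edgeDigits (k n) δ' δ) s ((sum_norm_sq_eigenCoord _).trans hψ) hsum
    rw [tensorApply_overlapMatrix, prod_edgeSites_overlapMatrix hvk hv hvb hvb' hs] at this
    refine ⟨measure_ne_top _ _, ?_⟩
    rw [husimi_rectangle_eq_cylinderMass hvk hv (Nat.div_le_self _ _) hvb hvb',
      ENNReal.toReal_ofReal (cylinderMass_nonneg _ _ _)]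
    exact this
  have htoReal : Tendsto (fun n => (husimi (k n) (k n / 2) (Ψ n) (rectangle δ' δ)).toReal) atTop
      (𝓝 (edgeWeight s δ' δ)) := by
    rw [tendsto_iff_dist_tendsto_zero]
    refine squeeze_zero' (Eventually.of_forall fun n => dist_nonneg) ?_ hbound
    filter_upwards [hreal] with n hn
    exact hn.2
  refine (ENNReal.tendsto_ofReal htoReal).congr' ?_
  filter_upwards [hreal] with n hn
  exact ENNReal.ofReal_toReal hn.1

lemma ofReal_canWeight (d : Fin 3) : ENNReal.ofReal (![1 / 2, 0, 1 / 2] d) = canDigits d := by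
  fin_cases d
  · simp [canDigits_zero]
  · simp [canDigits_one]
  · simp [canDigits_two]

lemma ofReal_edgeWeight (s : Fin 3) {v : ℕ} (δ' δ : Fin v → Fin 3) :
    ENNReal.ofReal (edgeWeight s δ' δ) =
      (∏ j, ENNReal.ofReal (‖eigenBasis s (δ j)‖ ^ 2)) * nuCan (triadicInterval δ') := by
  have hnn : ∀ d : Fin 3, 0 ≤ (![1 / 2, 0, 1 / 2] d : ℝ) := by
    intro d
    fin_cases d <;> simp
  rw [edgeWeight, ENNReal.ofReal_mul (Finset.prod_nonneg fun _ _ => sq_nonneg _),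
    ENNReal.ofReal_prod_of_nonneg fun _ _ => sq_nonneg _,
    ENNReal.ofReal_prod_of_nonneg fun _ _ => hnn _, nuCan_triadicInterval]
  simp only [ofReal_canWeight]

lemma rhoMax_rectangle {v : ℕ} (δ' δ : Fin v → Fin 3) :
    rhoMax (rectangle δ' δ) = ENNReal.ofReal (edgeWeight 0 δ' δ) := by
  rw [ofReal_edgeWeight, rhoMax, rectangle, Measure.prod_prod, nuCan_triadicInterval δ]
  simp only [norm_eigenBasis_zero_sq, ofReal_canWeight]

lemma rhoMin_rectangle {v : ℕ} (δ' δ : Fin v → Fin 3) :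
    rhoMin (rectangle δ' δ) = ENNReal.ofReal (edgeWeight 2 δ' δ) := by
  rw [ofReal_edgeWeight, rhoMin, rectangle, Measure.prod_prod, nuMin_triadicInterval δ]
  simp only [norm_eigenBasis_two_sq, minDigits_apply]

instance : IsProbabilityMeasure rhoMax := inferInstanceAs (IsProbabilityMeasure (nuCan.prod nuCan))
instance : IsProbabilityMeasure rhoMin := inferInstanceAs (IsProbabilityMeasure (nuMin.prod nuCan))

lemma rhoMax_torus_compl : rhoMax torusᶜ = 0 := prod_torus_compl nuCan_compl nuCan_compl
lemma rhoMin_torus_compl : rhoMin torusᶜ = 0 := prod_torus_compl nuMin_compl nuCan_compl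

lemma eventually_ne_zero_of_tendsto_norm {z : ℕ → ℂ} {r : ℝ} (hr : 0 < r)
    (h : Tendsto (fun n => ‖z n‖) atTop (𝓝 r)) : ∀ᶠ n in atTop, z n ≠ 0 := by
  filter_upwards [h.eventually_const_lt hr] with n hn
  exact norm_pos_iff.1 hn

theorem isEdgeLimit_rhoMax : IsEdgeLimit 1 rhoMax := by
  intro k Ψ z h hz
  have hsq : ConvergesOnSquares (fun n => husimi (k n) (k n / 2) (Ψ n)) rhoMax := by
    intro v δ' δ
    rw [rhoMax_rectangle]
    refine tendsto_husimi_rectangle h (eventually_ne_zero_of_tendsto_norm one_pos hz)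
      (by decide) ?_ δ' δ
    have := ((hz.pow 2).const_sub 1).const_mul (3 / 2)
    simpa [edgeDefect] using this
  exact ⟨hsq, hsq.convergesWeakStar (fun n => husimi_torus_compl _ _ _) rhoMax_torus_compl⟩

theorem isEdgeLimit_rhoMin : IsEdgeLimit (1 / Real.sqrt 3) rhoMin := by
  intro k Ψ z h hz
  have hsq : ConvergesOnSquares (fun n => husimi (k n) (k n / 2) (Ψ n)) rhoMin := by
    intro v δ' δ
    rw [rhoMin_rectangle]
    refine tendsto_husimi_rectangle h (eventually_ne_zero_of_tendsto_norm (by positivity) hz)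
      (by decide) ?_ δ' δ
    have := ((hz.pow 2).sub_const (1 / 3)).const_mul (3 / 2)
    rw [div_pow, Real.sq_sqrt (by norm_num), one_pow, sub_self, mul_zero] at this
    simpa [edgeDefect] using this
  exact ⟨hsq, hsq.convergesWeakStar (fun n => husimi_torus_compl _ _ _) rhoMin_torus_compl⟩

/-! ### Uniqueness of the edge limits -/

/-- The product state built from the one-site eigenvector number `s`. -/
def productState (s : Fin 3) (k : ℕ) : QState k :=
  WithLp.toLp 2 fun x => ∏ i, eigenBasis s (x i)

lemma isEigenstateSequence_productState {s : Fin 3} (hs : s ≠ 1) :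
    IsEigenstateSequence (fun n => n + 1) (fun n => productState s (n + 1))
      (fun _ => siteEigenvalue s) where
  tendsto_k := tendsto_add_atTop_nat 1
  norm_eq_one n := by
    rw [EuclideanSpace.norm_eq, productState]
    simp only
    rw [sum_norm_sq_prod_eigenBasis, Real.sqrt_one]
  eigen n := by
    rw [productState, Matrix.toLpLin_toLp, Matrix.toLin'_apply,
      openWalshBaker_mulVec_prod hs, WithLp.toLp_smul]

lemma norm_siteEigenvalue_zero : ‖siteEigenvalue 0‖ = 1 := by simp [siteEigenvalue]

lemma norm_siteEigenvalue_two : ‖siteEigenvalue 2‖ = 1 / Real.sqrt 3 := by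
  simp [siteEigenvalue, invSqrtThree]

/-- The edge limit is unique as soon as some one-site eigenvalue has the given modulus. -/
theorem IsEdgeLimit.unique {r : ℝ} {s : Fin 3} (hs : s ≠ 1) (hr : ‖siteEigenvalue s‖ = r)
    {ρ ρ' : Measure (ℝ × ℝ)} [IsFiniteMeasure ρ] (hρ : ρ torusᶜ = 0) (hρ' : ρ' torusᶜ = 0)
    (h : IsEdgeLimit r ρ) (h' : IsEdgeLimit r ρ') : ρ' = ρ := by
  -- An actual sequence at this edge is needed: without one, every measure would be an edge limit
  -- vacuously.
  have hseq := isEigenstateSequence_productState hs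
  have hlim : Tendsto (fun _ : ℕ => ‖siteEigenvalue s‖) atTop (𝓝 r) := hr ▸ tendsto_const_nhds
  exact (h _ _ _ hseq hlim).1.unique hρ hρ' (h' _ _ _ hseq hlim).1

end

end WalshBaker

open WalshBaker in
theorem theorem1 :
    -- the two measures on the line, given by their weights on triadic intervals
    (IsProbabilityMeasure nuCan ∧ nuCan (Set.Ico 0 1)ᶜ = 0 ∧
      ∀ (n : ℕ) (ε : Fin n → Fin 3), nuCan (triadicInterval ε) =
        if ∀ i, ε i = 0 ∨ ε i = 2 then (2⁻¹ : ℝ≥0∞) ^ n else 0) ∧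
    (IsProbabilityMeasure nuMin ∧ nuMin (Set.Ico 0 1)ᶜ = 0 ∧
      ∀ (n : ℕ) (ε : Fin n → Fin 3), nuMin (triadicInterval ε) =
        ∏ i, ENNReal.ofReal ((![1, 2, 1] (ε i) / Real.sqrt 6) ^ 2)) ∧
    -- outer edge
    (IsEdgeLimit 1 rhoMax ∧
      (∀ ρ : Measure (ℝ × ℝ), ρ torusᶜ = 0 → IsEdgeLimit 1 ρ → ρ = rhoMax) ∧
      MeasurePreserving baker rhoMax rhoMax ∧
      rhoMax repellerᶜ = 0) ∧
    -- inner edge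
    (IsEdgeLimit (1 / Real.sqrt 3) rhoMin ∧
      (∀ ρ : Measure (ℝ × ℝ), ρ torusᶜ = 0 → IsEdgeLimit (1 / Real.sqrt 3) ρ → ρ = rhoMin) ∧
      IsEigenmeasure (1 / 3) rhoMin ∧
      rhoMin backwardTrappedᶜ = 0 ∧
      -- self-similarity of `ν_min` and of `ρ_min`
      nuMin = ∑ i : Fin 3, minDigits i • nuMin.map (fun x : ℝ => (x + ((i : ℕ) : ℝ)) / 3) ∧
      rhoMin = ∑ i : Fin 3, ∑ j : Fin 3, (minDigits i * canDigits j) •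
        rhoMin.map (fun x : ℝ × ℝ => ((x.1 + ((i : ℕ) : ℝ)) / 3, (x.2 + ((j : ℕ) : ℝ)) / 3))) := by
  refine ⟨⟨inferInstance, nuCan_compl, fun n ε => ?_⟩, ⟨inferInstance, nuMin_compl, fun n ε => ?_⟩,
    ⟨isEdgeLimit_rhoMax, fun ρ hρ h => ?_, measurePreserving_baker_rhoMax, rhoMax_repeller_compl⟩,
    isEdgeLimit_rhoMin, fun ρ hρ h => ?_, isEigenmeasure_rhoMin, rhoMin_backwardTrapped_compl,
    bernoulliMeasure_selfSimilar minDigits, bernoulliMeasure_prod_selfSimilar minDigits canDigits⟩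
  · rw [nuCan_triadicInterval, prod_canDigits]
  · rw [nuMin_triadicInterval]
    exact Finset.prod_congr rfl fun i _ => minDigits_eq_sq _
  · exact isEdgeLimit_rhoMax.unique (s := 0) (by decide) norm_siteEigenvalue_zero
      rhoMax_torus_compl hρ h
  · exact isEdgeLimit_rhoMin.unique (s := 2) (by decide) norm_siteEigenvalue_two
      rhoMin_torus_compl hρ h
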